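/- Let $N\ge 2$, $\mathbf p\in[2,\infty)$, $s\in(\tfrac12,1)$. **The game.** Let $\alpha_{\mathbf p}\in(0,\frac{\pi}{2}]$ be the angle for which the spherical cap $A_{\mathbf p}=\{|z|=1,\ \angle(e_1,z)<\alpha_{\mathbf p}\}$ satisfies $\mathbf p-1=\int_{A_{\mathbf p}}\langle z,e_1\rangle^2\,d\sigma\big/\int_{A_{\mathbf p}}\langle z,e_2\rangle^2\,d\sigma$, where $\sigma$ is the surface measure of the unit sphere, and put $T=\{z\in\mathbb R^N:\ \angle(e_1,z)<\alpha_{\mathbf p},\ |z|>1\}$. Let $d\mu_s^N(z)=C(N,s)|z|^{-N-2s}\,dz$ with $C(N,s)=\frac{4^s s\Gamma(N/2+s)}{\pi^{N/2}\Gamma(1-s)}$. Let $\Omega_1=T\times\{1,2\}$ carry the product of the normalised measure $\mu_s^N/\mu_s^N(T)$ and the uniform measure on $\{1,2\}$, and let $(\Omega,\mathbb P)$ be the countable product of copies of $\Omega_1$, with elements $\omega=\{(z_i,s_i)\}_{i\ge1}$. A strategy is a sequence $\sigma=\{\sigma^n\}_{n\ge 0}$ of Borel maps $\sigma^n:\mathbb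 R^N\times(\mathbb R^N\times\Omega_1)^n\to\{|y|=1\}$. For a unit vector $y$ let $R_y\in SO(N)$ be the rotation in the plane of $e_1$ and $y$ with $R_ye_1=y$ ($R_{e_1}=\mathrm{Id}$; $R_{-e_1}$ is the half-turn in the plane of $e_1,e_2$). Given $\epsilon>0$, a starting point $x_0\in\mathbb R^N$ and strategies $\sigma_I,\sigma_{II}$, define $X_0=x_0$ and $$X_n=X_{n-1}+\epsilon R_{y_n}z_n,\qquad y_n=\begin{cases}\sigma_I^{n-1}(h_{n-1})& \text{if } s_n=1,\\ \sigma_{II}^{n-1}(h_{n-1})& \text{if } s_n=2,\end{cases}\qquad h_n=\big(X_0,(X_1,z_1,s_1),\ldots,(X_n,z_n,s_n)\big).$$ For a set $\mathcal D\subset\mathbb R^N$ let $\tau=\min\{n\ge1:\ X_n\notin\mathcal D\}$ (with $\tau=\infty$ if there is no such $n$). **Theorem.** Let $\mathcal D\subset\mathbb R^N$ be open, bounded, and satisfy the exterior cone condition: there is a finite cone $C=\{z:\ \angle(e_1,z)<\beta,\ 0<|z|<h\}$, with $\beta\in(0,\frac\pi2]$ and $h>0$, such that for each $x\in\partial\mathcal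 D$ there is a rotation $S_x\in SO(N)$ with $x+S_xC\subset\mathbb R^N\setminus\mathcal D$. Then every $x\in\partial\mathcal D$ is game-regular: for all $\xi,\delta>0$ there exist $\hat\delta,\hat\epsilon>0$ such that for every $\epsilon\in(0,\hat\epsilon)$ and every $\bar x\in B_{\hat\delta}(x)\cap\mathcal D$ there is a strategy $\sigma_I$ of Player I such that, for every strategy $\sigma_{II}$ of Player II, the game started at $x_0=\bar x$ satisfies $$\mathbb P\big(\tau<\infty\ \text{ and }\ X_\tau\in B_\delta(x)\big)\ \ge\ 1-\xi.$$ -/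

import Mathlib

noncomputable section

namespace TugOfWar

open MeasureTheory ProbabilityTheory Metric Set
open scoped ENNReal RealInnerProductSpace

/-- The Euclidean space `ℝ^N`. -/
abbrev E (N : ℕ) : Type := EuclideanSpace ℝ (Fin N)

/-- The first vector of the canonical basis. -/
def e₁ (N : ℕ) [N.AtLeastTwo] : E N := EuclideanSpace.single 0 1

/-- The second vector of the canonical basis. -/
def e₂ (N : ℕ) [N.AtLeastTwo] : E N := EuclideanSpace.single 1 1

/-! ### The cone `T_p` and the measure `μ_s^N` -/

/-- The spherical cap `A(α) = {|z| = 1, ∠(e₁, z) < α}`. -/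
def cap (N : ℕ) [N.AtLeastTwo] (α : ℝ) : Set (sphere (0 : E N) 1) :=
  {z | InnerProductGeometry.angle (e₁ N) z < α}

/-- The ratio `∫_{A(α)} ⟨z, e₁⟩² dσ / ∫_{A(α)} ⟨z, e₂⟩² dσ`, where `σ` is the surface measure
of the unit sphere. -/
def capRatio (N : ℕ) [N.AtLeastTwo] (α : ℝ) : ℝ :=
  (∫ z in cap N α, ⟪(z : E N), e₁ N⟫ ^ 2 ∂(volume : Measure (E N)).toSphere) /
    (∫ z in cap N α, ⟪(z : E N), e₂ N⟫ ^ 2 ∂(volume : Measure (E N)).toSphere)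

/-- The aperture angle `α_p`: the solution `α ∈ (0, π/2]` of `p - 1 = capRatio N α`.
The ratio decreases strictly and continuously from `∞` to `1` on `(0, π/2]`, so that for
`p ≥ 2` the set below has exactly one element, and `sSup` selects it. -/
def coneAngle (N : ℕ) [N.AtLeastTwo] (p : ℝ) : ℝ :=
  sSup {α | α ∈ Ioc 0 (Real.pi / 2) ∧ p - 1 = capRatio N α}

/-- The truncated infinite cone `T_p^{a,∞}(y) = {z; ∠(y, z) < α_p, a < |z|}`. -/
def truncCone (N : ℕ) [N.AtLeastTwo] (p a : ℝ) (y : E N) : Set (E N) :=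
  {z | InnerProductGeometry.angle y z < coneAngle N p ∧ a < ‖z‖}

/-- The constant `C(N,s) = 4^s s Γ(N/2 + s) / (π^{N/2} Γ(1 - s))`. -/
def fracConst (N : ℕ) (s : ℝ) : ℝ :=
  (4 : ℝ) ^ s * s * Real.Gamma ((N : ℝ) / 2 + s) /
    (Real.pi ^ ((N : ℝ) / 2) * Real.Gamma (1 - s))

/-- The measure `dμ_s^N(z) = C(N,s) |z|^{-N-2s} dz`. -/
def fracMeasure (N : ℕ) (s : ℝ) : Measure (E N) :=
  volume.withDensity fun z => ENNReal.ofReal (fracConst N s / ‖z‖ ^ ((N : ℝ) + 2 * s))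

/-- The rotation `R_{y, e₁} ∈ SO(N)` in the plane of `e₁` and `y` that carries `e₁` to the unit
vector `y`, written as the product of the reflections in the hyperplanes orthogonal to `e₁` and
to `e₁ + y`. For `y = e₁` it is the identity. For `y = -e₁`, where the plane is not determined,
the half-turn in the plane of `e₁` and `e₂` is taken. -/
def dirRotation (N : ℕ) [N.AtLeastTwo] (y : E N) : E N ≃ₗᵢ[ℝ] E N :=
  open Classical in
  ((ℝ ∙ e₁ N)ᗮ.reflection).trans
    ((ℝ ∙ (if y = -e₁ N then e₂ N else e₁ N + y))ᗮ.reflection)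

/-! ### The probability space -/

/-- One random outcome: `Ω₁ = T_p^{1,∞} × {1, 2}`. The value `true` of the second component
activates Player I, the value `false` activates Player II. -/
abbrev Outcome (N : ℕ) [N.AtLeastTwo] (p : ℝ) : Type :=
  truncCone N p 1 (e₁ N) × Bool

/-- The measure `μ_s^N` on `T_p^{1,∞}`, normalised to a probability measure. -/
def jumpLaw (N : ℕ) [N.AtLeastTwo] (p s : ℝ) : Measure (truncCone N p 1 (e₁ N)) :=
  (fracMeasure N s (truncCone N p 1 (e₁ N)))⁻¹ • (fracMeasure N s).comap Subtype.val

/-- The law `ℙ₁` of one outcome: product of `jumpLaw` with a fair coin. -/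
def outcomeLaw (N : ℕ) [N.AtLeastTwo] (p s : ℝ) : Measure (Outcome N p) :=
  (jumpLaw N p s).prod (uniformOn univ)

/-- The countable product `ℙ` of the laws `ℙ₁`; the `n`-th coordinate (`n = 0, 1, …`) of the
sample point is `(z_{n+1}, s_{n+1})`. -/
def gameMeasure (N : ℕ) [N.AtLeastTwo] (p s : ℝ) : Measure (ℕ → Outcome N p) :=
  Measure.infinitePi fun _ => outcomeLaw N p s

/-! ### Strategies and the game process -/

/-- Finite histories `H_n = ℝ^N × (ℝ^N × Ω₁)^n`, listing
`x₀, (x₁, z₁, s₁), …, (x_n, z_n, s_n)`. -/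
abbrev History (N : ℕ) [N.AtLeastTwo] (p : ℝ) (n : ℕ) : Type :=
  E N × (Fin n → E N × Outcome N p)

/-- The current position `x_n` recorded in a history of length `n`. -/
def History.last {N : ℕ} [N.AtLeastTwo] {p : ℝ} : {n : ℕ} → History N p n → E N
  | 0, h => h.1
  | n + 1, h => (h.2 (Fin.last n)).1

/-- A strategy: a sequence of Borel measurable maps from histories to unit vectors. -/
structure Strategy (N : ℕ) [N.AtLeastTwo] (p : ℝ) where
  /-- The direction chosen after a history of length `n`. -/
  move : (n : ℕ) → History N p n → sphere (0 : E N) 1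
  measurable_move : ∀ n, Measurable (move n)

/-- The history of the first `n` rounds of the game with parameter `ε`, started at `x`. -/
def gameHistory {N : ℕ} [N.AtLeastTwo] {p : ℝ} (ε : ℝ) (x : E N) (σI σII : Strategy N p) :
    (n : ℕ) → (ℕ → Outcome N p) → History N p n
  | 0, _ => (x, Fin.elim0)
  | n + 1, ω =>
    let h := gameHistory ε x σI σII n ω
    let y : sphere (0 : E N) 1 := if (ω n).2 then σI.move n h else σII.move n h
    (x, Fin.snoc h.2 (h.last + ε • dirRotation N (y : E N) ((ω n).1 : E N), ω n))

/-- The game position `X_n^{ε, x, σI, σII}`. -/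
def position {N : ℕ} [N.AtLeastTwo] {p : ℝ} (ε : ℝ) (x : E N) (σI σII : Strategy N p)
    (n : ℕ) (ω : ℕ → Outcome N p) : E N :=
  (gameHistory ε x σI σII n ω).last

/-- The exit time `τ = min {n ≥ 1; X_n ∉ D}`, with value `⊤` if there is no such `n`. -/
def exitTime {N : ℕ} [N.AtLeastTwo] {p : ℝ} (D : Set (E N)) (ε : ℝ) (x : E N)
    (σI σII : Strategy N p) : (ℕ → Outcome N p) → WithTop ℕ :=
  hittingAfter (position ε x σI σII) Dᶜ 1

/-- The exit position `X_τ` (meaningful on the event `τ < ⊤`). -/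
def exitPosition {N : ℕ} [N.AtLeastTwo] {p : ℝ} (D : Set (E N)) (ε : ℝ) (x : E N)
    (σI σII : Strategy N p) : (ℕ → Outcome N p) → E N :=
  stoppedValue (position ε x σI σII) (exitTime D ε x σI σII)

/-! ### Game-regularity and the exterior cone condition -/

/-- Game-regularity of the point `x`: for all `ξ, δ > 0`, whenever `ε` is small enough and the
starting point `x'` in `D` is close enough to `x`, Player I has a strategy such that, against
every strategy of Player II, the game ends and its exit position lies in `B_δ(x)` with
probability at least `1 - ξ`. -/
def GameRegular {N : ℕ} [N.AtLeastTwo] (p s : ℝ) (D : Set (E N)) (x : E N) : Prop :=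
  ∀ ξ > (0 : ℝ), ∀ δ > (0 : ℝ), ∃ δ' > (0 : ℝ), ∃ ε' > (0 : ℝ),
    ∀ ε, 0 < ε → ε < ε' → ∀ x' ∈ ball x δ' ∩ D,
      ∃ σI : Strategy N p, ∀ σII : Strategy N p,
        1 - ξ ≤ (gameMeasure N p s).real
          {ω | exitTime D ε x' σI σII ω < ⊤ ∧ exitPosition D ε x' σI σII ω ∈ ball x δ}

/-- The finite cone of half-aperture `β` and height `h`, with vertex `0` and axis `e₁`. -/
def finiteCone (N : ℕ) [N.AtLeastTwo] (β h : ℝ) : Set (E N) :=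
  {z | InnerProductGeometry.angle (e₁ N) z < β ∧ 0 < ‖z‖ ∧ ‖z‖ < h}

/-- The exterior cone condition: a rotated copy of one fixed finite cone, with its vertex placed
at any boundary point of `D`, stays outside `D`. -/
def ExteriorConeCondition {N : ℕ} [N.AtLeastTwo] (D : Set (E N)) : Prop :=
  ∃ β ∈ Ioc 0 (Real.pi / 2), ∃ h > (0 : ℝ), ∀ x ∈ frontier D,
    ∃ S : E N ≃ₗᵢ[ℝ] E N, LinearMap.det (S.toLinearEquiv : E N →ₗ[ℝ] E N) = 1 ∧
      ∀ z ∈ finiteCone N β h, x + S z ∉ D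

end TugOfWar

end

/-!
A cone exterior to `D` at `x` with axis `e` contains balls around points `v` close to `x`. The
level sets of the gauge `G z = coneGauge e (z - v)` are spheres whose centres lie on the axis, far
enough from `v` for the whole ball of radius `κ G z` around the centre to lie in the cone. Player I
always pulls towards the centre of the level sphere through the current position `X`. If the
opponent pulls in the opposite direction, the fair coin cancels the first-order terms of the two
jumps, and in general it leaves a sign that favours Player I. Since `p ≥ 2`, the cap law spreads no
more across the pull than along it, so the expected increase of `G ^ γ` from bounded jumps is at
most of order `γ G ^ γ (ε / G) ^ (2 s)`. With a probability of that same order, but without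
the factor `γ`, a single jump lands in the ball around the centre, hence outside `D`. For small `γ`
the gauge power, killed on the target, is therefore a nonnegative supermartingale until the exit,
the game ends almost surely by one long jump, and Markov's inequality bounds the
probability of missing the target.
-/

noncomputable section

namespace TugOfWar

open MeasureTheory ProbabilityTheory Metric Set
open scoped ENNReal RealInnerProductSpace Pointwise

/-! ### Angles and cones -/

section Angles

variable {F : Type*} [NormedAddCommGroup F] [InnerProductSpace ℝ F] {e : F}

lemma exists_ball_subset_cone (he : ‖e‖ = 1) {β : ℝ} (hβ : 0 < β) :
    ∃ κ : ℝ, 0 < κ ∧ κ ≤ 1 / 2 ∧ ∀ r > 0, ball (r • e) (κ * r) ⊆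
      {z | InnerProductGeometry.angle e z < β ∧ r / 2 < ‖z‖ ∧ ‖z‖ < 2 * r} := by
  have he0 : e ≠ 0 := norm_ne_zero_iff.mp (by simp [he])
  have hcont : ContinuousAt (fun z ↦ InnerProductGeometry.angle e z) e :=
    (InnerProductGeometry.continuousAt_angle (x := (e, e)) he0 he0).comp
      (f := fun z ↦ (e, z)) (by fun_prop)
  have hself : InnerProductGeometry.angle e e < β := by
    rwa [InnerProductGeometry.angle_self he0]
  obtain ⟨η, hη, hball⟩ := Metric.eventually_nhds_iff_ball.mp (hcont.eventually_lt_const hself)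
  refine ⟨min η (1 / 2), by positivity, min_le_right _ _, fun r hr z hz ↦ ?_⟩
  rw [mem_ball_iff_norm] at hz
  have hzr : ‖z - r • e‖ < r / 2 :=
    hz.trans_le (by nlinarith [min_le_right η (1 / 2)])
  have hre : ‖r • e‖ = r := by rw [norm_smul, he, Real.norm_of_nonneg hr.le, mul_one]
  have hupper := norm_le_norm_add_norm_sub' z (r • e)
  have hlower := norm_sub_norm_le (r • e) z
  rw [norm_sub_rev (r • e)] at hlower
  refine ⟨?_, by linarith, by linarith⟩
  rw [← InnerProductGeometry.angle_smul_right_of_pos e z (inv_pos.mpr hr)]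
  refine hball _ ?_
  rw [mem_ball_iff_norm]
  calc ‖r⁻¹ • z - e‖ = r⁻¹ * ‖z - r • e‖ := by
        rw [← norm_smul_of_nonneg (by positivity), smul_sub, inv_smul_smul₀ hr.ne']
    _ < r⁻¹ * (min η (1 / 2) * r) := by gcongr
    _ ≤ η := by
        rw [mul_comm (min _ _), inv_mul_cancel_left₀ hr.ne']
        exact min_le_left _ _

lemma continuous_angle_sphere (he : e ≠ 0) :
    Continuous fun z : sphere (0 : F) 1 ↦ InnerProductGeometry.angle e (z : F) :=
  continuous_iff_continuousAt.mpr fun z ↦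
    (InnerProductGeometry.continuousAt_angle (x := (e, (z : F))) he
      (norm_ne_zero_iff.mp (by simp))).comp (f := fun z : sphere (0 : F) 1 ↦ (e, (z : F)))
      (by fun_prop)

variable [MeasurableSpace F] [BorelSpace F]

lemma measurable_angle (e : F) :
    Measurable fun z ↦ InnerProductGeometry.angle e z := by
  unfold InnerProductGeometry.angle
  exact Real.continuous_arccos.measurable.comp (Measurable.div (by fun_prop) (by fun_prop))

/-- The action of a linear isometry on the unit sphere. -/
def sphereEquiv (L : F ≃ₗᵢ[ℝ] F) : sphere (0 : F) 1 ≃ᵐ sphere (0 : F) 1 :=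
  (L.toHomeomorph.subtype fun z ↦ by simp).toMeasurableEquiv

@[simp]
lemma coe_sphereEquiv (L : F ≃ₗᵢ[ℝ] F) (z : sphere (0 : F) 1) :
    (sphereEquiv L z : F) = L z := rfl

variable [FiniteDimensional ℝ F]

lemma addHaar_setOf_inner_eq_mul_norm (μ : Measure F) [μ.IsAddHaarMeasure] (he : ‖e‖ = 1)
    {c : ℝ} (hc : c ∈ Ico 0 1) : μ {x | ⟪e, x⟫ = c * ‖x‖} = 0 := by
  set K : Set F := {x | c * ‖x‖ ≤ ⟪e, x⟫}
  have hK : Convex ℝ K := by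
    have hconvex : ConvexOn ℝ univ fun x : F ↦ c • ‖x‖ := convexOn_univ_norm.smul hc.1
    simpa [K, sub_nonpos] using
      (hconvex.sub ((innerSL ℝ e).toLinearMap.concaveOn convex_univ)).convex_le 0
  refine measure_mono_null (fun x (hx : ⟪e, x⟫ = c * ‖x‖) ↦ ?_) (hK.addHaar_frontier μ)
  rw [frontier_eq_closure_inter_closure]
  refine ⟨subset_closure hx.ge, mem_closure_of_tendsto (f := fun t : ℝ ↦ x - t • e)
    (b := nhdsWithin 0 (Ioi 0)) ?_ ?_⟩
  · exact ((by fun_prop : Continuous fun t : ℝ ↦ x - t • e).tendsto' 0 x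
      (by simp)).mono_left nhdsWithin_le_nhds
  · filter_upwards [self_mem_nhdsWithin] with t (ht : 0 < t)
    have hnorm : ‖x‖ - t ≤ ‖x - t • e‖ := by
      simpa [norm_smul, he, abs_of_pos ht] using norm_sub_norm_le x (t • e)
    simp only [K, mem_compl_iff, mem_ofPred_eq, not_le, inner_sub_right, inner_smul_right,
      real_inner_self_eq_norm_sq, he, hx]
    nlinarith [mul_le_mul_of_nonneg_left hnorm hc.1, hc.2]

lemma toSphere_setOf_angle_eq (μ : Measure F) [μ.IsAddHaarMeasure] (he : ‖e‖ = 1)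
    {α : ℝ} (hα : α ∈ Ioc 0 (Real.pi / 2)) :
    μ.toSphere {z | InnerProductGeometry.angle e (z : F) = α} = 0 := by
  have hcos : Real.cos α ∈ Ico 0 1 :=
    ⟨Real.cos_nonneg_of_mem_Icc ⟨by linarith [hα.1, Real.pi_pos], hα.2⟩, by
      simpa using Real.cos_lt_cos_of_nonneg_of_le_pi_div_two le_rfl hα.2 hα.1⟩
  have hmeas : MeasurableSet
      {z : sphere (0 : F) 1 | InnerProductGeometry.angle e (z : F) = α} :=
    ((measurable_angle e).comp measurable_subtype_coe) (measurableSet_singleton α)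
  rw [Measure.toSphere_apply' _ hmeas]
  refine mul_eq_zero_of_right _
    (measure_mono_null ?_ (addHaar_setOf_inner_eq_mul_norm μ he hcos))
  rintro _ ⟨r, hr, _, ⟨z, rfl : InnerProductGeometry.angle e (z : F) = α, rfl⟩, rfl⟩
  have hz : ‖(z : F)‖ = 1 := by simp
  simp only [mem_ofPred_eq, inner_smul_right, norm_smul, InnerProductGeometry.cos_angle,
    Real.norm_of_nonneg hr.1.le, he, hz]
  ring

lemma measurePreserving_sphereEquiv (L : F ≃ₗᵢ[ℝ] F) :
    MeasurePreserving (sphereEquiv L) (volume : Measure F).toSphere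
      (volume : Measure F).toSphere := by
  refine ⟨(sphereEquiv L).measurable, Measure.ext fun s hs ↦ ?_⟩
  rw [(sphereEquiv L).map_apply, Measure.toSphere_apply' _ hs,
    Measure.toSphere_apply' _ ((sphereEquiv L).measurable hs)]
  have himage : Subtype.val '' s = L '' (Subtype.val '' (sphereEquiv L ⁻¹' s)) := by
    rw [image_image]
    conv_lhs => rw [← (sphereEquiv L).image_preimage s, image_image]
    rfl
  have hcone : Ioo (0 : ℝ) 1 • L '' (Subtype.val '' (sphereEquiv L ⁻¹' s)) =
      L '' (Ioo (0 : ℝ) 1 • Subtype.val '' (sphereEquiv L ⁻¹' s)) :=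
    (image_image2_distrib_right fun r z ↦ map_smul L r z).symm
  rw [himage, hcone, L.image_eq_preimage_symm,
    L.symm.measurePreserving.measure_preimage_emb L.symm.toHomeomorph.measurableEmbedding]

end Angles

/-! ### The aperture angle -/

lemma two_mul_setIntegral_eq_integral {X : Type*} [MeasurableSpace X] {μ : Measure X}
    {f : X → ℝ} (hf : Integrable f μ) {t : Set X} (ht : MeasurableSet t) {T : X ≃ᵐ X}
    (hT : MeasurePreserving T μ μ) (hfT : ∀ z, f (T z) = f z) (hTt : T ⁻¹' t =ᵐ[μ] tᶜ) :
    2 * ∫ z in t, f z ∂μ = ∫ z, f z ∂μ := by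
  have hcompl : ∫ z in tᶜ, f z ∂μ = ∫ z in t, f z ∂μ := by
    rw [← hT.setIntegral_preimage_emb T.measurableEmbedding f t, Measure.restrict_congr_set hTt]
    simp_rw [hfT]
    rfl
  rw [← integral_add_compl ht hf, hcompl, two_mul]

lemma integrable_toSphere {F : Type*} [NormedAddCommGroup F] [InnerProductSpace ℝ F]
    [FiniteDimensional ℝ F] [MeasurableSpace F] [BorelSpace F] {f : sphere (0 : F) 1 → ℝ}
    (hf : Continuous f) : Integrable f (volume : Measure F).toSphere := by
  simpa using hf.continuousOn.integrableOn_compact isCompact_univ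

section Aperture

variable {N : ℕ} [N.AtLeastTwo]

@[simp]
lemma norm_e₁ : ‖e₁ N‖ = 1 := by simp [e₁]

lemma e₁_ne_zero : e₁ N ≠ 0 := norm_ne_zero_iff.mp (by simp)

lemma inner_e₁ (z : E N) : ⟪z, e₁ N⟫ = z 0 := by
  simp [e₁, EuclideanSpace.inner_single_right]

lemma inner_e₂ (z : E N) : ⟪z, e₂ N⟫ = z 1 := by
  simp [e₂, EuclideanSpace.inner_single_right]

lemma fin_zero_ne_one : (0 : Fin N) ≠ 1 := by
  have := Nat.AtLeastTwo.prop (n := N)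
  rw [Ne, Fin.ext_iff, Fin.val_zero, Fin.val_one', Nat.mod_eq_of_lt (by lia)]
  exact zero_ne_one

lemma cos_angle_e₁ (z : sphere (0 : E N) 1) :
    Real.cos (InnerProductGeometry.angle (e₁ N) (z : E N)) = (z : E N) 0 := by
  rw [InnerProductGeometry.cos_angle, norm_e₁, real_inner_comm, inner_e₁]
  simp

lemma sq_add_sq_le_one (z : sphere (0 : E N) 1) : (z : E N) 0 ^ 2 + (z : E N) 1 ^ 2 ≤ 1 := by
  have hz : ‖(z : E N)‖ ^ 2 = 1 := by simp
  rw [EuclideanSpace.real_norm_sq_eq] at hz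
  refine le_of_le_of_eq ?_ hz
  rw [← Finset.sum_pair (f := fun i ↦ (z : E N) i ^ 2) fin_zero_ne_one]
  exact Finset.sum_le_sum_of_subset_of_nonneg (Finset.subset_univ _) fun _ _ _ ↦ sq_nonneg _

lemma isOpen_cap (α : ℝ) : IsOpen (cap N α) :=
  isOpen_lt (continuous_angle_sphere e₁_ne_zero) continuous_const

lemma ae_angle_e₁_ne {α : ℝ} (hα : α ∈ Ioc 0 (Real.pi / 2)) :
    ∀ᵐ z : sphere (0 : E N) 1 ∂(volume : Measure (E N)).toSphere,
      InnerProductGeometry.angle (e₁ N) (z : E N) ≠ α := by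
  rw [ae_iff]
  simpa using toSphere_setOf_angle_eq volume norm_e₁ hα

lemma continuousOn_setIntegral_cap {f : sphere (0 : E N) 1 → ℝ} (hf : Continuous f) :
    ContinuousOn (fun α ↦ ∫ z in cap N α, f z ∂(volume : Measure (E N)).toSphere)
      (Ioc 0 (Real.pi / 2)) := by
  intro α hα
  apply ContinuousAt.continuousWithinAt
  have hcap : ∀ α, MeasurableSet (cap N α) := fun α ↦ (isOpen_cap α).measurableSet
  simp_rw [← integral_indicator (hcap _)]
  refine continuousAt_of_dominated (bound := fun z ↦ ‖f z‖)
    (.of_forall fun x ↦ (hf.measurable.indicator (hcap x)).aestronglyMeasurable)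
    (.of_forall fun x ↦ .of_forall fun z ↦ norm_indicator_le_norm_self _ _)
    (integrable_toSphere hf).norm ?_
  filter_upwards [ae_angle_e₁_ne hα] with z hz
  rcases lt_or_gt_of_ne hz with h | h
  · refine continuousAt_const.congr (f := fun _ ↦ f z) ?_
    filter_upwards [lt_mem_nhds h] with x hx
    exact (indicator_of_mem (s := cap N x) hx f).symm
  · refine continuousAt_const.congr (f := fun _ ↦ 0) ?_
    filter_upwards [gt_mem_nhds h] with x hx
    exact (indicator_of_notMem (s := cap N x) (lt_asymm hx) f).symm

lemma integral_sq_sub_sq_eq_zero :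
    ∫ z, ((z : E N) 0 ^ 2 - (z : E N) 1 ^ 2) ∂(volume : Measure (E N)).toSphere = 0 := by
  set f : sphere (0 : E N) 1 → ℝ := fun z ↦ (z : E N) 0 ^ 2 - (z : E N) 1 ^ 2
  set T := sphereEquiv (LinearIsometryEquiv.piLpCongrLeft 2 ℝ ℝ (Equiv.swap (0 : Fin N) 1))
  have hneg : ∀ z, f (T z) = -f z := fun z ↦ by
    simp [f, T, LinearIsometryEquiv.piLpCongrLeft_apply, Equiv.piCongrLeft']
  have hswap := (measurePreserving_sphereEquiv _).integral_comp' (f := T) f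
  simp_rw [hneg, integral_neg] at hswap
  linarith

lemma setIntegral_cap_pi_div_two :
    ∫ z in cap N (Real.pi / 2), ((z : E N) 0 ^ 2 - (z : E N) 1 ^ 2)
      ∂(volume : Measure (E N)).toSphere = 0 := by
  have hhalf : sphereEquiv (LinearIsometryEquiv.neg ℝ) ⁻¹' cap N (Real.pi / 2)
      =ᵐ[(volume : Measure (E N)).toSphere] (cap N (Real.pi / 2))ᶜ := by
    filter_upwards [ae_angle_e₁_ne (N := N) ⟨by positivity, le_rfl⟩] with z hz
    change (InnerProductGeometry.angle (e₁ N) (-(z : E N)) < _) = ¬ (_ < Real.pi / 2)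
    rw [InnerProductGeometry.angle_neg_right, eq_iff_iff, not_lt]
    exact ⟨fun h ↦ by linarith, fun h ↦ by linarith [lt_of_le_of_ne h hz.symm]⟩
  have := two_mul_setIntegral_eq_integral
    (f := fun z : sphere (0 : E N) 1 ↦ (z : E N) 0 ^ 2 - (z : E N) 1 ^ 2)
    (integrable_toSphere (by fun_prop)) (isOpen_cap _).measurableSet
    (measurePreserving_sphereEquiv (LinearIsometryEquiv.neg ℝ)) (fun z ↦ by simp) hhalf
  rw [integral_sq_sub_sq_eq_zero] at this
  linarith

lemma exists_setIntegral_cap_nonneg {k : ℝ} (hk : 0 < k) :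
    ∃ α ∈ Ioo 0 (Real.pi / 2), 0 ≤ ∫ z in cap N α, ((z : E N) 0 ^ 2 - k * (z : E N) 1 ^ 2)
      ∂(volume : Measure (E N)).toSphere := by
  have hlim : ∀ᶠ α in nhdsWithin (0 : ℝ) (Ioi 0), k / (1 + k) < Real.cos α ^ 2 := by
    refine nhdsWithin_le_nhds (Continuous.continuousAt (by fun_prop) |>.eventually_const_lt ?_)
    rw [Real.cos_zero, one_pow, div_lt_one (by positivity)]
    linarith
  obtain ⟨α, hcos, hα⟩ := (hlim.and (Ioo_mem_nhdsGT Real.pi_div_two_pos)).exists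
  refine ⟨α, hα, setIntegral_nonneg (isOpen_cap α).measurableSet fun z hz ↦ ?_⟩
  have hz0 : Real.cos α ≤ (z : E N) 0 := by
    rw [← cos_angle_e₁]
    exact Real.cos_le_cos_of_nonneg_of_le_pi (InnerProductGeometry.angle_nonneg _ _)
      (by linarith [hα.2, Real.pi_pos]) (le_of_lt hz)
  have hsq := hcos.trans_le (pow_le_pow_left₀
    (Real.cos_nonneg_of_mem_Icc ⟨by linarith [hα.1, Real.pi_pos], hα.2.le⟩) hz0 2)
  rw [div_lt_iff₀ (by positivity)] at hsq
  nlinarith [sq_add_sq_le_one z]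

lemma setIntegral_cap_sq_pos {α : ℝ} (hα : α ∈ Ioc 0 (Real.pi / 2)) :
    0 < ∫ z in cap N α, (z : E N) 0 ^ 2 ∂(volume : Measure (E N)).toSphere := by
  rw [setIntegral_pos_iff_support_of_nonneg_ae (.of_forall fun z ↦ sq_nonneg _)
    (integrable_toSphere (by fun_prop)).integrableOn]
  have hsub : cap N α ⊆ Function.support fun z : sphere (0 : E N) 1 ↦ (z : E N) 0 ^ 2 := by
    intro z hz
    rw [Function.mem_support, ← cos_angle_e₁ z]
    refine pow_ne_zero _ (Real.cos_pos_of_mem_Ioo ⟨?_, lt_of_lt_of_le hz hα.2⟩).ne'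
    linarith [Real.pi_pos, InnerProductGeometry.angle_nonneg (e₁ N) (z : E N)]
  rw [inter_eq_right.mpr hsub]
  refine (isOpen_cap α).measure_pos _ ⟨⟨e₁ N, by simp⟩, ?_⟩
  simpa [cap, InnerProductGeometry.angle_self e₁_ne_zero] using hα.1

lemma exists_eq_capRatio {p : ℝ} (hp : 2 ≤ p) :
    ∃ α ∈ Ioc 0 (Real.pi / 2), p - 1 = capRatio N α := by
  set μ := (volume : Measure (E N)).toSphere
  have hint : ∀ {f : sphere (0 : E N) 1 → ℝ}, Continuous f → ∀ s, IntegrableOn f s μ :=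
    fun hf s ↦ (integrable_toSphere hf).integrableOn
  have hend : ∫ z in cap N (Real.pi / 2),
      ((z : E N) 0 ^ 2 - (p - 1) * (z : E N) 1 ^ 2) ∂μ ≤ 0 := by
    rw [← setIntegral_cap_pi_div_two (N := N)]
    refine setIntegral_mono (hint (by fun_prop) _) (hint (by fun_prop) _) fun z ↦ ?_
    nlinarith [sq_nonneg ((z : E N) 1)]
  obtain ⟨α₀, hα₀, hstart⟩ := exists_setIntegral_cap_nonneg (N := N) (k := p - 1) (by linarith)
  obtain ⟨α, hα, hzero⟩ := intermediate_value_Icc' hα₀.2.le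
    ((continuousOn_setIntegral_cap (by fun_prop)).mono fun x hx ↦ ⟨hα₀.1.trans_le hx.1, hx.2⟩)
    ⟨hend, hstart⟩
  have hα' : α ∈ Ioc 0 (Real.pi / 2) := ⟨hα₀.1.trans_le hα.1, hα.2⟩
  have heq : ∫ z in cap N α, (z : E N) 0 ^ 2 ∂μ = (p - 1) * ∫ z in cap N α, (z : E N) 1 ^ 2 ∂μ := by
    rw [← sub_eq_zero, ← integral_const_mul,
      ← integral_sub (hint (by fun_prop) _) (hint (by fun_prop) _)]
    exact hzero
  have hpos := setIntegral_cap_sq_pos (N := N) hα'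
  refine ⟨α, hα', ?_⟩
  simp only [capRatio, inner_e₁, inner_e₂]
  rw [eq_div_iff (right_ne_zero_of_mul (heq ▸ hpos.ne')), heq]

lemma coneAngle_mem {p : ℝ} (hp : 2 ≤ p) : coneAngle N p ∈ Ioc 0 (Real.pi / 2) := by
  obtain ⟨α, hα, h⟩ := exists_eq_capRatio (N := N) hp
  have hbdd : BddAbove {α | α ∈ Ioc 0 (Real.pi / 2) ∧ p - 1 = capRatio N α} :=
    ⟨Real.pi / 2, fun x hx ↦ hx.1.2⟩
  exact ⟨hα.1.trans_le (le_csSup hbdd ⟨hα, h⟩), csSup_le ⟨α, hα, h⟩ fun x hx ↦ hx.1.2⟩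

end Aperture

section Rotation

variable {N : ℕ} [N.AtLeastTwo]

lemma dirRotation_e₁ {y : E N} (hy : ‖y‖ = 1) :
    dirRotation N y (e₁ N) = y := by
  have h1 : (ℝ ∙ e₁ N)ᗮ.reflection (e₁ N) = -e₁ N :=
    Submodule.reflection_orthogonalComplement_singleton_eq_neg _
  simp only [dirRotation, LinearIsometryEquiv.trans_apply, h1]
  split_ifs with h
  · rw [Submodule.reflection_mem_subspace_eq_self, h]
    rw [Submodule.mem_orthogonal_singleton_iff_inner_left, inner_neg_left, inner_e₂]
    simp [e₁, fin_zero_ne_one.symm]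
  · have := Submodule.reflection_sub (F := E N) (v := -e₁ N) (w := y)
      (by rw [norm_neg, norm_e₁, hy])
    have hspan : (ℝ ∙ (-e₁ N - y)) = ℝ ∙ (e₁ N + y) := by
      rw [← neg_add', ← Set.neg_singleton, Submodule.span_neg]
    simpa only [hspan] using this

lemma measurable_dirRotation :
    Measurable fun q : E N × E N ↦ dirRotation N q.1 q.2 := by
  classical
  have heq : (fun q : E N × E N ↦ dirRotation N q.1 q.2) = fun q : E N × E N ↦
      (fun u : E N × E N ↦ -(2 • (⟪u.1, u.2⟫ / ‖u.1‖ ^ 2) • u.1 - u.2))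
        (if q.1 = -e₁ N then e₂ N else e₁ N + q.1, (ℝ ∙ e₁ N)ᗮ.reflection q.2) := by
    ext1 q
    simp only [dirRotation, LinearIsometryEquiv.trans_apply]
    rw [Submodule.reflection_orthogonal_apply (ℝ ∙ _), Submodule.reflection_singleton_apply]
    simp only [RCLike.ofReal_real_eq_id, id]
  rw [heq]
  refine Measurable.comp (g := fun u : E N × E N ↦
    -(2 • (⟪u.1, u.2⟫ / ‖u.1‖ ^ 2) • u.1 - u.2)) (by fun_prop) (Measurable.prodMk ?_ ?_)
  · refine Measurable.ite ?_ measurable_const (by fun_prop)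
    exact measurable_fst (measurableSet_singleton _)
  · exact (LinearIsometryEquiv.continuous _).measurable.comp measurable_snd

end Rotation

/-! ### The law of one jump -/

/-- The modulus `min r² r` of the error of a first order expansion: quadratic near `0` and linear
at infinity, hence integrable against `|z|^{-N-2s} dz` for `s ∈ (1/2, 1)`. -/
def sqMin (r : ℝ) : ℝ := min (r ^ 2) r

lemma sqMin_nonneg {r : ℝ} (hr : 0 ≤ r) : 0 ≤ sqMin r := le_min (sq_nonneg r) hr

lemma continuous_sqMin : Continuous sqMin := by unfold sqMin; fun_prop

lemma sqMin_of_one_le {r : ℝ} (hr : 1 ≤ r) : sqMin r = r := min_eq_right (by nlinarith)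

lemma sqMin_of_le_one {r : ℝ} (h0 : 0 ≤ r) (hr : r ≤ 1) : sqMin r = r ^ 2 :=
  min_eq_left (by nlinarith)

section FracMeasure

variable {N : ℕ} {s : ℝ}

lemma fracConst_pos (hs : 0 < s) (hs' : s < 1) : 0 < fracConst N s := by
  have := Real.Gamma_pos_of_pos (s := (N : ℝ) / 2 + s) (by positivity)
  have := Real.Gamma_pos_of_pos (s := 1 - s) (by linarith)
  unfold fracConst
  positivity

lemma measurable_fracDensity :
    Measurable fun z : E N ↦ ENNReal.ofReal (fracConst N s / ‖z‖ ^ ((N : ℝ) + 2 * s)) := by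
  fun_prop

lemma isOpenPosMeasure_fracMeasure [NeZero N] (hs : 0 < s) (hs' : s < 1) :
    (fracMeasure N s).IsOpenPosMeasure := by
  have hne : ∀ᵐ z : E N, z ≠ 0 := by simp [ae_iff]
  refine (withDensity_absolutelyContinuous' measurable_fracDensity.aemeasurable
    (hne.mono fun z hz ↦ ?_)).isOpenPosMeasure
  have hC := fracConst_pos (N := N) hs hs'
  have := norm_pos_iff.mpr hz
  exact (ENNReal.ofReal_pos.mpr (by positivity)).ne'

lemma map_smul_fracMeasure {t : ℝ} (ht : 0 < t) :
    (fracMeasure N s).map (t • ·) = ENNReal.ofReal (t ^ (2 * s)) • fracMeasure N s := by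
  have hsmul : Measurable fun z : E N ↦ t • z := measurable_const_smul t
  have hdens : ∀ z : E N, ENNReal.ofReal (fracConst N s / ‖z‖ ^ ((N : ℝ) + 2 * s)) =
      ENNReal.ofReal (t ^ ((N : ℝ) + 2 * s)) *
        ENNReal.ofReal (fracConst N s / ‖t • z‖ ^ ((N : ℝ) + 2 * s)) := fun z ↦ by
    have := (Real.rpow_pos_of_pos ht ((N : ℝ) + 2 * s)).ne'
    rw [← ENNReal.ofReal_mul (by positivity), norm_smul, Real.norm_of_nonneg ht.le,
      Real.mul_rpow ht.le (norm_nonneg z), mul_div_assoc', mul_div_mul_left _ _ this]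
  ext A hA
  rw [Measure.map_apply hsmul hA, Measure.smul_apply, fracMeasure, withDensity_apply _ hA,
    withDensity_apply _ (hsmul hA), lintegral_congr hdens,
    lintegral_const_mul _ (by fun_prop),
    ← setLIntegral_map hA measurable_fracDensity hsmul, Measure.map_addHaar_smul _ ht.ne',
    Measure.restrict_smul, lintegral_smul_measure, smul_eq_mul, smul_eq_mul, ← mul_assoc,
    ← ENNReal.ofReal_mul (by positivity), finrank_euclideanSpace_fin, abs_of_pos (by positivity),
    Real.rpow_add ht, Real.rpow_natCast, mul_right_comm, mul_inv_cancel₀ (by positivity), one_mul]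

lemma measurePreserving_fracMeasure (L : E N ≃ₗᵢ[ℝ] E N) :
    MeasurePreserving L (fracMeasure N s) (fracMeasure N s) := by
  refine ⟨L.continuous.measurable, Measure.ext fun t ht ↦ ?_⟩
  rw [Measure.map_apply L.continuous.measurable ht, fracMeasure, withDensity_apply _ ht,
    withDensity_apply _ (L.continuous.measurable ht),
    ← L.measurePreserving.setLIntegral_comp_preimage ht measurable_fracDensity]
  simp

lemma integrable_sqMin_div_rpow [NeZero N] (hs : 1 / 2 < s) (hs' : s < 1) :
    Integrable (fun z : E N ↦ sqMin ‖z‖ / ‖z‖ ^ ((N : ℝ) + 2 * s)) := by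
  rw [integrable_fun_norm_addHaar volume (f := fun r ↦ sqMin r / r ^ ((N : ℝ) + 2 * s)),
    ← Ioc_union_Ioi_eq_Ioi zero_le_one, integrableOn_union]
  have hpow : ∀ y : ℝ, y ^ (Module.finrank ℝ (E N) - 1) = y ^ ((N : ℝ) - 1) := by
    intro y
    rw [finrank_euclideanSpace_fin, ← Real.rpow_natCast, Nat.cast_sub NeZero.one_le, Nat.cast_one]
  constructor
  · have h : IntegrableOn (fun y : ℝ ↦ y ^ (1 - 2 * s)) (Ioc 0 1) :=
      (intervalIntegral.intervalIntegrable_rpow' (by linarith)).1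
    refine h.congr_fun (fun y hy ↦ ?_) measurableSet_Ioc
    simp only [smul_eq_mul]
    rw [hpow y, sqMin_of_le_one hy.1.le hy.2, ← Real.rpow_natCast y 2, ← Real.rpow_sub hy.1,
      ← Real.rpow_add hy.1]
    congr 1; push_cast; ring
  · have h : IntegrableOn (fun y : ℝ ↦ y ^ (-(2 * s))) (Ioi 1) :=
      integrableOn_Ioi_rpow_of_lt (by linarith) one_pos
    refine h.congr_fun (fun y hy ↦ ?_) measurableSet_Ioi
    have hy0 : 0 < y := one_pos.trans hy
    simp only [smul_eq_mul]
    rw [hpow y, sqMin_of_one_le (le_of_lt hy)]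
    nth_rw 3 [← Real.rpow_one y]
    rw [← Real.rpow_sub hy0, ← Real.rpow_add hy0]
    congr 1; ring

lemma lintegral_sqMin_fracMeasure_lt_top [NeZero N] (hs : 1 / 2 < s) (hs' : s < 1) :
    ∫⁻ z, ENNReal.ofReal (sqMin ‖z‖) ∂fracMeasure N s < ∞ := by
  have hsqMin : Measurable fun z : E N ↦ ENNReal.ofReal (sqMin ‖z‖) :=
    (continuous_sqMin.comp continuous_norm).measurable.ennreal_ofReal
  have hC := fracConst_pos (N := N) (by linarith) hs'
  have hfin := ((integrable_sqMin_div_rpow (N := N) hs hs').const_mul (fracConst N s)).2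
  rw [hasFiniteIntegral_iff_ofReal (.of_forall fun z ↦
    mul_nonneg hC.le (div_nonneg (sqMin_nonneg (norm_nonneg z)) (by positivity)))] at hfin
  rw [fracMeasure, lintegral_withDensity_eq_lintegral_mul _ measurable_fracDensity hsqMin]
  refine (lintegral_congr fun z ↦ ?_).trans_lt hfin
  rw [Pi.mul_apply, ← ENNReal.ofReal_mul (by positivity), div_mul_eq_mul_div, mul_div_assoc]

lemma lintegral_sqMin_smul_fracMeasure {t : ℝ} (ht : 0 < t) :
    ∫⁻ z, ENNReal.ofReal (sqMin ‖t • z‖) ∂fracMeasure N s =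
      ENNReal.ofReal (t ^ (2 * s)) * ∫⁻ z, ENNReal.ofReal (sqMin ‖z‖) ∂fracMeasure N s := by
  have hsqMin : Measurable fun z : E N ↦ ENNReal.ofReal (sqMin ‖z‖) :=
    (continuous_sqMin.comp continuous_norm).measurable.ennreal_ofReal
  rw [← smul_eq_mul, ← lintegral_smul_measure, ← map_smul_fracMeasure ht,
    lintegral_map hsqMin (measurable_const_smul t)]

end FracMeasure

section JumpLaw

variable {N : ℕ} [N.AtLeastTwo] {p s : ℝ}

lemma measurableSet_truncCone : MeasurableSet (truncCone N p 1 (e₁ N)) :=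
  (measurable_angle (e₁ N) measurableSet_Iio).inter (measurable_norm measurableSet_Ioi)

lemma one_lt_norm (z : truncCone N p 1 (e₁ N)) : 1 < ‖(z : E N)‖ := z.2.2

lemma fracMeasure_truncCone_lt_top (hs : 1 / 2 < s) (hs' : s < 1) :
    fracMeasure N s (truncCone N p 1 (e₁ N)) < ∞ := by
  refine lt_of_le_of_lt ?_ (lintegral_sqMin_fracMeasure_lt_top (N := N) hs hs')
  rw [← lintegral_indicator_one measurableSet_truncCone]
  refine lintegral_mono (indicator_le fun z hz ↦ ?_)
  rw [sqMin_of_one_le hz.2.le]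
  exact ENNReal.one_le_ofReal.mpr hz.2.le

lemma fracMeasure_truncCone_pos (hp : 2 ≤ p) (hs : 0 < s) (hs' : s < 1) :
    0 < fracMeasure N s (truncCone N p 1 (e₁ N)) := by
  have := isOpenPosMeasure_fracMeasure (N := N) hs hs'
  obtain ⟨κ, hκ0, -, hball⟩ :=
    exists_ball_subset_cone (norm_e₁ (N := N)) (coneAngle_mem (N := N) hp).1
  refine (measure_ball_pos _ _ (by positivity)).trans_le
    (measure_mono (s := ball ((2 : ℝ) • e₁ N) (κ * 2)) fun z hz ↦ ?_)
  obtain ⟨hangle, hnorm, -⟩ := hball 2 two_pos hz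
  exact ⟨hangle, by linarith⟩

lemma isProbabilityMeasure_jumpLaw (hp : 2 ≤ p) (hs : 1 / 2 < s) (hs' : s < 1) :
    IsProbabilityMeasure (jumpLaw N p s) := by
  refine ⟨?_⟩
  rw [jumpLaw, Measure.smul_apply, comap_subtype_coe_apply measurableSet_truncCone,
    image_univ, Subtype.range_coe, smul_eq_mul]
  exact ENNReal.inv_mul_cancel (fracMeasure_truncCone_pos hp (by linarith) hs').ne'
    (fracMeasure_truncCone_lt_top hs hs').ne

lemma map_jumpLaw :
    (jumpLaw N p s).map Subtype.val = (fracMeasure N s (truncCone N p 1 (e₁ N)))⁻¹ •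
      (fracMeasure N s).restrict (truncCone N p 1 (e₁ N)) := by
  rw [jumpLaw, Measure.map_smul, map_comap_subtype_coe measurableSet_truncCone]

lemma exists_integral_sqMin_le (hp : 2 ≤ p) (hs : 1 / 2 < s) (hs' : s < 1) :
    ∃ K > 0, ∀ t > 0,
      Integrable (fun z : truncCone N p 1 (e₁ N) ↦ sqMin ‖t • (z : E N)‖) (jumpLaw N p s) ∧
      ∫ z : truncCone N p 1 (e₁ N), sqMin ‖t • (z : E N)‖ ∂jumpLaw N p s ≤ K * t ^ (2 * s) := by
  have hpos := fracMeasure_truncCone_pos (N := N) hp (by linarith) hs'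
  set A := (fracMeasure N s (truncCone N p 1 (e₁ N)))⁻¹ *
    ∫⁻ z, ENNReal.ofReal (sqMin ‖z‖) ∂fracMeasure N s with hA
  have hAtop : A < ∞ := ENNReal.mul_lt_top (ENNReal.inv_lt_top.mpr hpos)
    (lintegral_sqMin_fracMeasure_lt_top hs hs')
  refine ⟨A.toReal + 1, by positivity, fun t ht ↦ ?_⟩
  have hmeas : Measurable fun z : E N ↦ sqMin ‖t • z‖ :=
    (continuous_sqMin.comp (continuous_const_smul t).norm).measurable
  have hnonneg : ∀ z : truncCone N p 1 (e₁ N), 0 ≤ sqMin ‖t • (z : E N)‖ :=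
    fun z ↦ sqMin_nonneg (norm_nonneg _)
  have hle : ∫⁻ z : truncCone N p 1 (e₁ N), ENNReal.ofReal (sqMin ‖t • (z : E N)‖)
      ∂jumpLaw N p s ≤ ENNReal.ofReal (t ^ (2 * s)) * A := by
    rw [← lintegral_map hmeas.ennreal_ofReal measurable_subtype_coe, map_jumpLaw,
      lintegral_smul_measure, hA, mul_left_comm, smul_eq_mul, ← lintegral_sqMin_smul_fracMeasure ht]
    gcongr
    exact Measure.restrict_le_self
  have hfin : ENNReal.ofReal (t ^ (2 * s)) * A < ∞ := ENNReal.mul_lt_top ENNReal.ofReal_lt_top hAtop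
  have hmeas' := (hmeas.comp (measurable_subtype_coe
    (p := (· ∈ truncCone N p 1 (e₁ N))))).aestronglyMeasurable (μ := jumpLaw N p s)
  refine ⟨⟨hmeas', ?_⟩, ?_⟩
  · exact (hasFiniteIntegral_iff_ofReal (.of_forall hnonneg)).mpr (hle.trans_lt hfin)
  · rw [integral_eq_lintegral_of_nonneg_ae (.of_forall hnonneg) hmeas']
    refine (ENNReal.toReal_mono hfin.ne hle).trans ?_
    rw [ENNReal.toReal_mul, ENNReal.toReal_ofReal (by positivity), mul_comm]
    gcongr
    linarith

lemma jumpLaw_smul_mem {B : Set (E N)} (hB : MeasurableSet B) {t : ℝ} (ht : 0 < t)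
    (hsub : ∀ z, t • z ∈ B → z ∈ truncCone N p 1 (e₁ N)) :
    jumpLaw N p s {z | t • (z : E N) ∈ B} = ENNReal.ofReal (t ^ (2 * s)) *
      ((fracMeasure N s (truncCone N p 1 (e₁ N)))⁻¹ * fracMeasure N s B) := by
  have hsmul : Measurable fun z : E N ↦ t • z := measurable_const_smul t
  have hscale : fracMeasure N s ((t • ·) ⁻¹' B) =
      ENNReal.ofReal (t ^ (2 * s)) * fracMeasure N s B := by
    rw [← Measure.map_apply hsmul hB, map_smul_fracMeasure ht, Measure.smul_apply, smul_eq_mul]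
  change jumpLaw N p s (Subtype.val ⁻¹' ((t • ·) ⁻¹' B)) = _
  rw [← Measure.map_apply measurable_subtype_coe (hsmul hB), map_jumpLaw, Measure.smul_apply,
    Measure.restrict_apply (hsmul hB), inter_eq_left.mpr (show (t • ·) ⁻¹' B ⊆ _ from hsub), hscale,
    smul_eq_mul, mul_left_comm]

lemma exists_le_jumpLaw_smul_mem_ball (hp : 2 ≤ p) (hs : 1 / 2 < s) (hs' : s < 1) {κ : ℝ}
    (hκ : 0 < κ) : ∃ c > 0, ∀ t ∈ Ioc (0 : ℝ) (1 / 2),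
      c * t ^ (2 * s) ≤ (jumpLaw N p s).real {z | t • (z : E N) ∈ ball (e₁ N) κ} := by
  have := isProbabilityMeasure_jumpLaw (N := N) hp hs hs'
  have := isOpenPosMeasure_fracMeasure (N := N) (by linarith) hs'
  obtain ⟨κ', hκ', -, hcone⟩ :=
    exists_ball_subset_cone (norm_e₁ (N := N)) (coneAngle_mem (N := N) hp).1
  have hmem : ∀ t ∈ Ioc (0 : ℝ) (1 / 2), ∀ z, t • z ∈ ball (e₁ N) (min κ κ') →
      z ∈ truncCone N p 1 (e₁ N) := by
    intro t ht z hz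
    have hz' : t • z ∈ ball ((1 : ℝ) • e₁ N) (κ' * 1) := by
      simpa only [one_smul, mul_one] using ball_subset_ball (min_le_right κ κ') hz
    obtain ⟨hangle, hnorm, -⟩ := hcone 1 one_pos hz'
    rw [InnerProductGeometry.angle_smul_right_of_pos _ _ ht.1] at hangle
    rw [norm_smul, Real.norm_of_nonneg ht.1.le] at hnorm
    exact ⟨hangle, by nlinarith [ht.1, ht.2, norm_nonneg z]⟩
  have hlaw := fun t ht ↦ jumpLaw_smul_mem (s := s) measurableSet_ball (mem_Ioc.mp ht).1 (hmem t ht)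
  set A := (fracMeasure N s (truncCone N p 1 (e₁ N)))⁻¹ * fracMeasure N s (ball (e₁ N) (min κ κ'))
  have hA0 : A ≠ 0 := mul_ne_zero
    (ENNReal.inv_ne_zero.mpr (fracMeasure_truncCone_lt_top hs hs').ne)
    (measure_ball_pos _ _ (lt_min hκ hκ')).ne'
  have hAtop : A ≠ ∞ := by
    intro hA
    have h := hlaw (1 / 2) ⟨by norm_num, le_rfl⟩
    rw [hA, ENNReal.mul_top (ENNReal.ofReal_pos.mpr (by positivity)).ne'] at h
    exact measure_ne_top _ _ h
  refine ⟨A.toReal, ENNReal.toReal_pos hA0 hAtop, fun t ht ↦ ?_⟩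
  have ht0 := ht.1
  have hreal : A.toReal * t ^ (2 * s) =
      (jumpLaw N p s).real {z | t • (z : E N) ∈ ball (e₁ N) (min κ κ')} := by
    rw [measureReal_def, hlaw t ht, mul_comm, ENNReal.toReal_mul (a := ENNReal.ofReal _),
      ENNReal.toReal_ofReal (by positivity)]
  rw [hreal]
  exact measureReal_mono (preimage_mono (ball_subset_ball (min_le_left κ κ')))

lemma jumpLaw_norm_le_lt_one (hp : 2 ≤ p) (hs : 1 / 2 < s) (hs' : s < 1) (M : ℝ) :
    jumpLaw N p s {z | ‖(z : E N)‖ ≤ M} < 1 := by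
  have := isProbabilityMeasure_jumpLaw (N := N) hp hs hs'
  obtain ⟨c, hc, hball⟩ := exists_le_jumpLaw_smul_mem_ball (N := N) hp hs hs' one_half_pos
  set R := max 1 M
  have hR : 0 < R := by positivity
  set t := (2 * R)⁻¹
  have ht : t ∈ Ioc 0 (1 / 2) := ⟨by positivity, by
    rw [one_div]; exact inv_anti₀ two_pos (by linarith [le_max_left 1 M])⟩
  have hlong : {z : truncCone N p 1 (e₁ N) | t • (z : E N) ∈ ball (e₁ N) (1 / 2)} ⊆
      {z | ‖(z : E N)‖ ≤ M}ᶜ := by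
    intro z (hz : t • (z : E N) ∈ ball (e₁ N) (1 / 2)) (hzM : ‖(z : E N)‖ ≤ M)
    rw [mem_ball_iff_norm'] at hz
    have hshort : t * ‖(z : E N)‖ ≤ t * R := by gcongr; exact hzM.trans (le_max_right _ _)
    have htR : t * R = 1 / 2 := by simp only [t]; field_simp
    have := norm_sub_norm_le (e₁ N) (t • (z : E N))
    rw [norm_e₁, norm_smul, Real.norm_of_nonneg ht.1.le] at this
    linarith
  refine lt_of_le_of_ne prob_le_one fun h ↦ ?_
  rw [← prob_compl_eq_zero_iff (measurableSet_le (by fun_prop) measurable_const)] at h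
  have hpos : 0 < c * t ^ (2 * s) := mul_pos hc (Real.rpow_pos_of_pos ht.1 _)
  have := (hball t ht).trans (measureReal_mono hlong)
  rw [measureReal_def, h, ENNReal.toReal_zero] at this
  linarith

lemma integrable_jumpLaw (hp : 2 ≤ p) (hs : 1 / 2 < s) (hs' : s < 1) :
    Integrable (fun z : truncCone N p 1 (e₁ N) ↦ (z : E N)) (jumpLaw N p s) := by
  obtain ⟨K, -, hK⟩ := exists_integral_sqMin_le (N := N) hp hs hs'
  refine (hK 1 one_pos).1.mono' measurable_subtype_coe.aestronglyMeasurable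
    (.of_forall fun z ↦ ?_)
  rw [one_smul, sqMin_of_one_le (one_lt_norm z).le]

lemma inner_e₁_nonneg (hp : 2 ≤ p) (z : truncCone N p 1 (e₁ N)) : 0 ≤ ⟪e₁ N, (z : E N)⟫ := by
  rw [← InnerProductGeometry.cos_angle_mul_norm_mul_norm]
  have := Real.cos_nonneg_of_mem_Icc (x := InnerProductGeometry.angle (e₁ N) (z : E N))
    ⟨by linarith [Real.pi_pos, InnerProductGeometry.angle_nonneg (e₁ N) (z : E N)],
      z.2.1.le.trans (coneAngle_mem hp).2⟩
  positivity

lemma measurePreserving_reflection_map_jumpLaw :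
    MeasurePreserving (ℝ ∙ e₁ N).reflection ((jumpLaw N p s).map Subtype.val)
      ((jumpLaw N p s).map Subtype.val) := by
  set ρ := (ℝ ∙ e₁ N).reflection
  have hρ : ρ (e₁ N) = e₁ N :=
    Submodule.reflection_mem_subspace_eq_self (Submodule.mem_span_singleton_self _)
  have hangle : ∀ z, InnerProductGeometry.angle (e₁ N) (ρ z) =
      InnerProductGeometry.angle (e₁ N) z := fun z ↦ by
    conv_lhs => rw [← hρ]
    exact ρ.toLinearIsometry.angle_map _ _
  have hpre : ρ ⁻¹' truncCone N p 1 (e₁ N) = truncCone N p 1 (e₁ N) := by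
    ext z
    simp [truncCone, hangle]
  have hrestrict := (measurePreserving_fracMeasure (s := s) ρ).restrict_preimage
    (measurableSet_truncCone (N := N) (p := p))
  rw [hpre] at hrestrict
  rw [map_jumpLaw]
  exact hrestrict.smul_measure _

lemma exists_integral_jumpLaw_eq_smul (hp : 2 ≤ p) (hs : 1 / 2 < s) (hs' : s < 1) :
    ∃ m : ℝ, 0 ≤ m ∧ ∫ z, (z : E N) ∂jumpLaw N p s = m • e₁ N := by
  set w := ∫ z : truncCone N p 1 (e₁ N), (z : E N) ∂jumpLaw N p s with hw
  set ρ := (ℝ ∙ e₁ N).reflection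
  have hfix : ρ w = w := by
    have hmap : w = ∫ z, z ∂(jumpLaw N p s).map Subtype.val := by
      rw [integral_map measurable_subtype_coe.aemeasurable (by fun_prop)]
    have hcomm := ρ.toContinuousLinearEquiv.integral_comp_comm
      (μ := (jumpLaw N p s).map Subtype.val) fun z ↦ z
    rw [hmap]
    exact hcomm.symm.trans (measurePreserving_reflection_map_jumpLaw.integral_comp
      ρ.toHomeomorph.measurableEmbedding fun z ↦ z)
  rw [Submodule.reflection_eq_self_iff, Submodule.mem_span_singleton] at hfix
  obtain ⟨m, hm⟩ := hfix
  refine ⟨m, ?_, hm.symm⟩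
  have hinner : m = ∫ z : truncCone N p 1 (e₁ N), ⟪e₁ N, (z : E N)⟫ ∂jumpLaw N p s := by
    rw [integral_inner (integrable_jumpLaw hp hs hs'), ← hw, ← hm, inner_smul_right,
      real_inner_self_eq_norm_sq, norm_e₁, one_pow, mul_one]
  rw [hinner]
  exact integral_nonneg (inner_e₁_nonneg hp)

end JumpLaw

section Gauge

variable {F : Type*} [NormedAddCommGroup F] [InnerProductSpace ℝ F]

/-- The gauge of the half-line spanned by a unit vector `e`: its level set at height `g` is the
sphere of radius `2g/3` centred at `(g/3) • e`, and these spheres are nested and shrink to the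
origin, which is not their centre. -/
def coneGauge (e x : F) : ℝ := √(⟪x, e⟫ ^ 2 + 3 * ‖x‖ ^ 2) - ⟪x, e⟫

open Classical in
/-- The direction from `x` to the centre of the level sphere of `coneGauge e` through `x`; at the
origin, where that sphere degenerates to a point, the direction `e` is taken. -/
def pullDir (e x : F) : F :=
  if x = 0 then e else (3 / (2 * coneGauge e x)) • ((coneGauge e x / 3) • e - x)

/-- The logarithmic slope of `coneGauge e` at `x`, against the direction `pullDir e x`. -/
def gaugeSlope (e x : F) : ℝ := 2 / √(⟪x, e⟫ ^ 2 + 3 * ‖x‖ ^ 2)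

lemma continuous_coneGauge (e : F) : Continuous (coneGauge e) := by
  unfold coneGauge; fun_prop

lemma measurable_pullDir [MeasurableSpace F] [BorelSpace F] [SecondCountableTopology F] (e : F) :
    Measurable (pullDir e) := by
  have hG := (continuous_coneGauge e).measurable
  exact .ite (measurableSet_singleton 0) measurable_const
    (((hG.const_mul 2).const_div 3).smul (((hG.div_const 3).smul_const e).sub measurable_id))

lemma gaugeSlope_nonneg (e x : F) : 0 ≤ gaugeSlope e x := by
  unfold gaugeSlope; positivity

lemma coneGauge_sq (e x : F) :
    coneGauge e x ^ 2 + 2 * ⟪x, e⟫ * coneGauge e x = 3 * ‖x‖ ^ 2 := by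
  have := Real.sq_sqrt (show 0 ≤ ⟪x, e⟫ ^ 2 + 3 * ‖x‖ ^ 2 by positivity)
  rw [coneGauge]
  linear_combination this

lemma coneGauge_le_two_mul_sqrt (e x : F) :
    coneGauge e x ≤ 2 * √(⟪x, e⟫ ^ 2 + 3 * ‖x‖ ^ 2) := by
  have : |⟪x, e⟫| ≤ √(⟪x, e⟫ ^ 2 + 3 * ‖x‖ ^ 2) := Real.abs_le_sqrt (by linarith [sq_nonneg ‖x‖])
  rw [coneGauge]
  linarith [neg_abs_le ⟪x, e⟫]

variable {e : F}

lemma abs_inner_le_norm (he : ‖e‖ = 1) (x : F) : |⟪x, e⟫| ≤ ‖x‖ := by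
  simpa only [he, mul_one] using abs_real_inner_le_norm x e

lemma norm_le_coneGauge (he : ‖e‖ = 1) (x : F) : ‖x‖ ≤ coneGauge e x := by
  have h := abs_le.mp (abs_inner_le_norm he x)
  rw [coneGauge, le_sub_iff_add_le]
  apply Real.le_sqrt_of_sq_le
  nlinarith [norm_nonneg x]

lemma coneGauge_nonneg (he : ‖e‖ = 1) (x : F) : 0 ≤ coneGauge e x :=
  (norm_nonneg x).trans (norm_le_coneGauge he x)

lemma coneGauge_pos (he : ‖e‖ = 1) {x : F} (hx : x ≠ 0) : 0 < coneGauge e x :=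
  (norm_pos_iff.mpr hx).trans_le (norm_le_coneGauge he x)

lemma coneGauge_le (he : ‖e‖ = 1) (x : F) : coneGauge e x ≤ 3 * ‖x‖ := by
  have h := abs_le.mp (abs_inner_le_norm he x)
  have : √(⟪x, e⟫ ^ 2 + 3 * ‖x‖ ^ 2) ≤ 2 * ‖x‖ := by
    rw [Real.sqrt_le_left (by positivity)]
    nlinarith [norm_nonneg x]
  rw [coneGauge]
  linarith

lemma norm_smul_sub_eq_coneGauge (he : ‖e‖ = 1) (x : F) :
    ‖(coneGauge e x / 3) • e - x‖ = 2 / 3 * coneGauge e x := by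
  have h0 := coneGauge_nonneg he x
  rw [← sq_eq_sq₀ (norm_nonneg _) (by positivity), norm_sub_sq_real, norm_smul, he,
    real_inner_smul_left, real_inner_comm, Real.norm_of_nonneg (by positivity), mul_one]
  linear_combination (-1 / 3 : ℝ) * coneGauge_sq e x

lemma norm_pullDir (he : ‖e‖ = 1) (x : F) : ‖pullDir e x‖ = 1 := by
  by_cases hx : x = 0
  · rwa [pullDir, if_pos hx]
  · have := coneGauge_pos he hx
    rw [pullDir, if_neg hx, norm_smul, norm_smul_sub_eq_coneGauge he,
      Real.norm_of_nonneg (by positivity)]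
    field_simp

lemma add_smul_pullDir (he : ‖e‖ = 1) {x : F} (hx : x ≠ 0) :
    x + (2 / 3 * coneGauge e x) • pullDir e x = (coneGauge e x / 3) • e := by
  have := coneGauge_pos he hx
  rw [pullDir, if_neg hx, smul_smul,
    show 2 / 3 * coneGauge e x * (3 / (2 * coneGauge e x)) = 1 by field_simp, one_smul]
  abel

lemma coneGauge_mul_slope_mul_inner (he : ‖e‖ = 1) {x : F} (hx : x ≠ 0) (w : F) :
    coneGauge e x * (gaugeSlope e x * ⟪pullDir e x, w⟫) =
      (coneGauge e x * ⟪w, e⟫ - 3 * ⟪x, w⟫) / √(⟪x, e⟫ ^ 2 + 3 * ‖x‖ ^ 2) := by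
  have := coneGauge_pos he hx
  rw [pullDir, if_neg hx, gaugeSlope, real_inner_smul_left, inner_sub_left, real_inner_smul_left,
    real_inner_comm w e]
  field_simp

/-- `2 S S' ≤ S² + S'²` bounds the square root `S'` at `x + w` by its tangent at `x`. -/
lemma coneGauge_add_le_of_norm_le (he : ‖e‖ = 1) {x : F} (hx : x ≠ 0) (w : F) :
    coneGauge e (x + w) ≤ coneGauge e x *
      (1 - gaugeSlope e x * ⟪pullDir e x, w⟫ + 4 * (‖w‖ / coneGauge e x) ^ 2) := by
  have hG := coneGauge_pos he hx
  have hlin := coneGauge_mul_slope_mul_inner he hx w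
  have hGS := coneGauge_le_two_mul_sqrt e x
  have hGdef : coneGauge e x = √(⟪x, e⟫ ^ 2 + 3 * ‖x‖ ^ 2) - ⟪x, e⟫ := rfl
  have hSsq := Real.sq_sqrt (show 0 ≤ ⟪x, e⟫ ^ 2 + 3 * ‖x‖ ^ 2 by positivity)
  set G := coneGauge e x
  set S := √(⟪x, e⟫ ^ 2 + 3 * ‖x‖ ^ 2)
  set S' := √(⟪x + w, e⟫ ^ 2 + 3 * ‖x + w‖ ^ 2) with hS'
  have hS : 0 < S := by linarith
  have hS'sq : S' ^ 2 = S ^ 2 + 2 * (⟪x, e⟫ * ⟪w, e⟫ + 3 * ⟪x, w⟫) +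
      (⟪w, e⟫ ^ 2 + 3 * ‖w‖ ^ 2) := by
    rw [hS', Real.sq_sqrt (by positivity), hSsq, inner_add_left, norm_add_sq_real]; ring
  have hw : ⟪w, e⟫ ^ 2 ≤ ‖w‖ ^ 2 := sq_le_sq' (abs_le.mp (abs_inner_le_norm he w)).1
    (abs_le.mp (abs_inner_le_norm he w)).2
  have hquad : (⟪w, e⟫ ^ 2 + 3 * ‖w‖ ^ 2) / (2 * S) ≤ 4 * ‖w‖ ^ 2 / G := by
    gcongr; linarith
  calc coneGauge e (x + w) = S' - ⟪x + w, e⟫ := rfl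
    _ ≤ (S ^ 2 + S' ^ 2) / (2 * S) - ⟪x + w, e⟫ := by
        gcongr; rw [le_div_iff₀ (by positivity)]; linarith [two_mul_le_add_sq S S']
    _ = G - (G * ⟪w, e⟫ - 3 * ⟪x, w⟫) / S + (⟪w, e⟫ ^ 2 + 3 * ‖w‖ ^ 2) / (2 * S) := by
        rw [hS'sq, hGdef, inner_add_left]; field_simp; ring
    _ ≤ G - G * (gaugeSlope e x * ⟪pullDir e x, w⟫) + 4 * ‖w‖ ^ 2 / G := by rw [hlin]; gcongr
    _ = _ := by field_simp

lemma coneGauge_mul_slope_mul_inner_le (he : ‖e‖ = 1) {x : F} (hx : x ≠ 0) (w : F) :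
    coneGauge e x * (gaugeSlope e x * ⟪pullDir e x, w⟫) ≤ 4 * ‖w‖ := by
  have hG := coneGauge_pos he hx
  have hS : 0 < √(⟪x, e⟫ ^ 2 + 3 * ‖x‖ ^ 2) := by linarith [coneGauge_le_two_mul_sqrt e x]
  have hslope : coneGauge e x * gaugeSlope e x ≤ 4 := by
    rw [gaugeSlope, mul_div_assoc', div_le_iff₀ hS]
    linarith [coneGauge_le_two_mul_sqrt e x]
  have hinner : ⟪pullDir e x, w⟫ ≤ ‖w‖ := by
    simpa only [norm_pullDir he, one_mul] using real_inner_le_norm (pullDir e x) w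
  rw [← mul_assoc]
  calc coneGauge e x * gaugeSlope e x * ⟪pullDir e x, w⟫
      ≤ coneGauge e x * gaugeSlope e x * ‖w‖ :=
        mul_le_mul_of_nonneg_left hinner (mul_nonneg hG.le (gaugeSlope_nonneg e x))
    _ ≤ 4 * ‖w‖ := by gcongr

lemma coneGauge_add_le (he : ‖e‖ = 1) {x : F} (hx : x ≠ 0) (w : F) :
    coneGauge e (x + w) ≤ coneGauge e x *
      (1 - gaugeSlope e x * ⟪pullDir e x, w⟫ + 10 * sqMin (‖w‖ / coneGauge e x)) := by
  have hG := coneGauge_pos he hx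
  rcases le_total ‖w‖ (coneGauge e x) with hw | hw
  · rw [sqMin_of_le_one (by positivity) ((div_le_one hG).mpr hw)]
    refine (coneGauge_add_le_of_norm_le he hx w).trans ?_
    gcongr
    norm_num
  · rw [sqMin_of_one_le ((one_le_div hG).mpr hw)]
    have hfar : coneGauge e (x + w) ≤ 6 * ‖w‖ := by
      linarith [norm_add_le x w, coneGauge_le he (x + w), norm_le_coneGauge he x]
    have hcancel : coneGauge e x * (10 * (‖w‖ / coneGauge e x)) = 10 * ‖w‖ := by field_simp
    linarith [coneGauge_mul_slope_mul_inner_le he hx w]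

lemma rpow_coneGauge_add_div_le (he : ‖e‖ = 1) {x : F} (hx : x ≠ 0) {γ : ℝ} (hγ0 : 0 ≤ γ)
    (hγ1 : γ ≤ 1) (w : F) :
    (coneGauge e (x + w) / coneGauge e x) ^ γ ≤
      1 + γ * (-(gaugeSlope e x * ⟪pullDir e x, w⟫) + 10 * sqMin (‖w‖ / coneGauge e x)) := by
  have hG := coneGauge_pos he hx
  have hratio : coneGauge e (x + w) / coneGauge e x - 1 ≤
      -(gaugeSlope e x * ⟪pullDir e x, w⟫) + 10 * sqMin (‖w‖ / coneGauge e x) := by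
    rw [sub_le_iff_le_add, div_le_iff₀ hG, mul_comm]
    linarith [coneGauge_add_le he hx w]
  have hnonneg : 0 ≤ coneGauge e (x + w) / coneGauge e x := div_nonneg (coneGauge_nonneg he _) hG.le
  have hbernoulli := rpow_one_add_le_one_add_mul_self
    (s := coneGauge e (x + w) / coneGauge e x - 1) (by linarith) hγ0 hγ1
  rw [add_sub_cancel] at hbernoulli
  exact hbernoulli.trans (by gcongr)

lemma one_sixth_le_rpow_coneGauge_div (he : ‖e‖ = 1) {g γ : ℝ} (hg : 0 < g) (hγ0 : 0 ≤ γ)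
    (hγ1 : γ ≤ 1) {z : F} (hz : z ∈ ball ((g / 3) • e) (g / 6)) :
    1 / 6 ≤ (coneGauge e z / g) ^ γ := by
  have hnorm : g / 6 ≤ ‖z‖ := by
    have := norm_sub_norm_le ((g / 3) • e) z
    rw [mem_ball_iff_norm'] at hz
    rw [norm_smul, he, Real.norm_of_nonneg (by positivity), mul_one] at this
    linarith
  have hratio : 1 / 6 ≤ coneGauge e z / g := by
    rw [le_div_iff₀ hg]
    linarith [norm_le_coneGauge he z]
  calc (1 / 6 : ℝ) ≤ (1 / 6 : ℝ) ^ γ := by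
        simpa only [Real.rpow_one] using
          Real.rpow_le_rpow_of_exponent_ge (by norm_num : (0 : ℝ) < 1 / 6) (by norm_num) hγ1
    _ ≤ _ := Real.rpow_le_rpow (by norm_num) hratio hγ0

lemma barrier_add_le (he : ‖e‖ = 1) {x : F} (hx : x ≠ 0) {γ M : ℝ} (hγ0 : 0 ≤ γ) (hγ1 : γ ≤ 1)
    (hM : 0 < M) {B : Set F} (hB : B ⊆ ball ((coneGauge e x / 3) • e) (coneGauge e x / 6))
    {U : F → ℝ} (hU : ∀ z, U z ≤ (coneGauge e z / M) ^ γ) (hUB : ∀ z ∈ B, U z ≤ 0) (w : F) :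
    U (x + w) ≤ (coneGauge e x / M) ^ γ *
      (1 + γ * (-(gaugeSlope e x * ⟪pullDir e x, w⟫) + 10 * sqMin (‖w‖ / coneGauge e x)) -
        B.indicator (fun _ ↦ 1 / 6) (x + w)) := by
  have hG := coneGauge_pos he hx
  have hGw := coneGauge_nonneg he (x + w)
  have hstep := rpow_coneGauge_add_div_le he hx hγ0 hγ1 w
  by_cases hw : x + w ∈ B
  · rw [indicator_of_mem hw]
    refine (hUB _ hw).trans (mul_nonneg (by positivity) ?_)
    linarith [one_sixth_le_rpow_coneGauge_div he hG hγ0 hγ1 (hB hw)]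
  · rw [indicator_of_notMem hw, sub_zero]
    refine (hU _).trans ?_
    rw [← div_mul_div_cancel₀ hG.ne' (c := M), Real.mul_rpow (by positivity) (by positivity),
      mul_comm]
    gcongr

end Gauge

section BarrierStep

lemma integral_barrier_add_le {F : Type*} [NormedAddCommGroup F] [InnerProductSpace ℝ F]
    [CompleteSpace F] {Ω : Type*} [MeasurableSpace Ω] {P : Measure Ω} [IsProbabilityMeasure P]
    {W : Ω → F} (hW : Integrable W P) {e x : F} (he : ‖e‖ = 1) (hx : x ≠ 0) {γ M : ℝ}
    (hγ : γ ∈ Ioc 0 1) (hM : 0 < M) {B : Set F}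
    (hB : B ⊆ ball ((coneGauge e x / 3) • e) (coneGauge e x / 6))
    (hWB : MeasurableSet {ω | x + W ω ∈ B}) {U : F → ℝ}
    (hU : ∀ z, U z ∈ Icc 0 ((coneGauge e z / M) ^ γ)) (hUB : ∀ z ∈ B, U z ≤ 0) :
    ∫ ω, U (x + W ω) ∂P ≤ (coneGauge e x / M) ^ γ *
      (1 + γ * (-(gaugeSlope e x * ⟪pullDir e x, ∫ ω, W ω ∂P⟫) +
        10 * ∫ ω, sqMin (‖W ω‖ / coneGauge e x) ∂P) - 1 / 6 * P.real {ω | x + W ω ∈ B}) := by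
  have hG := coneGauge_pos he hx
  have hinner : Integrable (fun ω ↦ -(gaugeSlope e x * ⟪pullDir e x, W ω⟫)) P :=
    ((hW.const_inner _).const_mul _).neg
  have hsq : Integrable (fun ω ↦ 10 * sqMin (‖W ω‖ / coneGauge e x)) P :=
    ((hW.norm.div_const _).mono' (continuous_sqMin.comp_aestronglyMeasurable
      (hW.norm.div_const _).aestronglyMeasurable) (.of_forall fun _ ↦ by
        rw [Real.norm_of_nonneg (sqMin_nonneg (by positivity))]
        exact min_le_right _ _)).const_mul 10
  have hsum : Integrable (fun ω ↦ γ * (-(gaugeSlope e x * ⟪pullDir e x, W ω⟫) +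
      10 * sqMin (‖W ω‖ / coneGauge e x))) P := (hinner.add hsq).const_mul γ
  have hlin : Integrable (fun ω ↦ 1 + γ * (-(gaugeSlope e x * ⟪pullDir e x, W ω⟫) +
      10 * sqMin (‖W ω‖ / coneGauge e x))) P := (integrable_const 1).add hsum
  have hkill : Integrable ({ω | x + W ω ∈ B}.indicator fun _ ↦ (1 / 6 : ℝ)) P :=
    (integrable_const _).indicator hWB
  calc ∫ ω, U (x + W ω) ∂P
      ≤ ∫ ω, (coneGauge e x / M) ^ γ * (1 + γ * (-(gaugeSlope e x * ⟪pullDir e x, W ω⟫) +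
          10 * sqMin (‖W ω‖ / coneGauge e x)) -
            {ω | x + W ω ∈ B}.indicator (fun _ ↦ 1 / 6) ω) ∂P :=
        integral_mono_of_nonneg (.of_forall fun ω ↦ (hU _).1) ((hlin.sub hkill).const_mul _)
          (.of_forall fun ω ↦
            barrier_add_le he hx hγ.1.le hγ.2 hM hB (fun z ↦ (hU z).2) hUB (W ω))
    _ = _ := by
        rw [integral_const_mul, integral_sub hlin hkill, integral_indicator_const _ hWB,
          integral_add (integrable_const _) hsum, integral_const_mul, integral_add hinner hsq,
          integral_neg, integral_const_mul, integral_const_mul, integral_inner hW, integral_const,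
          probReal_univ, smul_eq_mul, smul_eq_mul, one_mul, mul_comm (P.real _)]

variable {N : ℕ} [N.AtLeastTwo] {p s : ℝ}

lemma integrable_smul_dirRotation (hp : 2 ≤ p) (hs : 1 / 2 < s) (hs' : s < 1) (ε : ℝ) (q : E N) :
    Integrable (fun z : truncCone N p 1 (e₁ N) ↦ ε • dirRotation N q (z : E N))
      (jumpLaw N p s) :=
  ((dirRotation N q).toContinuousLinearEquiv.integrable_comp_iff.mpr
    (integrable_jumpLaw hp hs hs')).smul ε

lemma integral_smul_dirRotation {m : ℝ} (hm : ∫ z, (z : E N) ∂jumpLaw N p s = m • e₁ N) (ε : ℝ)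
    {q : E N} (hq : ‖q‖ = 1) :
    ∫ z : truncCone N p 1 (e₁ N), ε • dirRotation N q (z : E N) ∂jumpLaw N p s =
      (ε * m) • q := by
  have hrot : ∫ z : truncCone N p 1 (e₁ N), dirRotation N q (z : E N) ∂jumpLaw N p s =
      dirRotation N q (∫ z, (z : E N) ∂jumpLaw N p s) :=
    (dirRotation N q).toContinuousLinearEquiv.integral_comp_comm _
  rw [integral_smul, hrot, hm, map_smul, dirRotation_e₁ hq, smul_smul]

lemma norm_smul_dirRotation_div {ε g : ℝ} (q z : E N) (hg : 0 ≤ g) :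
    ‖ε • dirRotation N q z‖ / g = ‖(ε / g) • z‖ := by
  rw [norm_smul, norm_smul, LinearIsometryEquiv.norm_map, norm_div, Real.norm_of_nonneg hg]
  ring

lemma measurableSet_add_smul_dirRotation_mem {B : Set (E N)} (hB : MeasurableSet B) (ε : ℝ)
    (x q : E N) :
    MeasurableSet {z : truncCone N p 1 (e₁ N) | x + ε • dirRotation N q (z : E N) ∈ B} :=
  ((((dirRotation N q).continuous.measurable.comp measurable_subtype_coe).const_smul ε).const_add
    x) hB

lemma add_smul_pullDir_mem_ball_iff {e x : E N} (he : ‖e‖ = 1) (hx : x ≠ 0) (ε κ : ℝ) (z : E N) :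
    x + ε • dirRotation N (pullDir e x) z ∈
        ball ((coneGauge e x / 3) • e) (κ * (coneGauge e x / 3)) ↔
      (ε / (2 / 3 * coneGauge e x)) • z ∈ ball (e₁ N) (κ / 2) := by
  have hr : 0 < 2 / 3 * coneGauge e x := mul_pos (by norm_num) (coneGauge_pos he hx)
  have hdiff : x + ε • dirRotation N (pullDir e x) z - (coneGauge e x / 3) • e =
      (2 / 3 * coneGauge e x) •
        dirRotation N (pullDir e x) ((ε / (2 / 3 * coneGauge e x)) • z - e₁ N) := by
    rw [map_sub, map_smul, dirRotation_e₁ (norm_pullDir he x), ← add_smul_pullDir he hx, smul_sub,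
      smul_smul, mul_div_cancel₀ _ hr.ne']
    abel
  rw [mem_ball_iff_norm, mem_ball_iff_norm, hdiff, norm_smul, LinearIsometryEquiv.norm_map,
    Real.norm_of_nonneg hr.le,
    show κ * (coneGauge e x / 3) = 2 / 3 * coneGauge e x * (κ / 2) by ring,
    mul_lt_mul_iff_right₀ hr]

lemma exists_le_jumpLaw_add_smul_pullDir_mem (hp : 2 ≤ p) (hs : 1 / 2 < s) (hs' : s < 1) {κ : ℝ}
    (hκ : 0 < κ) : ∃ c > 0, ∀ {e x : E N} {ε : ℝ}, ‖e‖ = 1 → 0 < ε → 3 * ε ≤ coneGauge e x →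
      c * (ε / coneGauge e x) ^ (2 * s) ≤ (jumpLaw N p s).real
        {z | x + ε • dirRotation N (pullDir e x) (z : E N) ∈
          ball ((coneGauge e x / 3) • e) (κ * (coneGauge e x / 3))} := by
  obtain ⟨c, hc, hball⟩ := exists_le_jumpLaw_smul_mem_ball (N := N) hp hs hs' (half_pos hκ)
  refine ⟨c, hc, fun {e x ε} he hε hG ↦ ?_⟩
  have hx : x ≠ 0 := norm_pos_iff.mp (by linarith [coneGauge_le he x])
  have hg := coneGauge_pos he hx
  have ht : ε / (2 / 3 * coneGauge e x) ∈ Ioc 0 (1 / 2) :=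
    ⟨by positivity, by rw [div_le_iff₀ (by positivity)]; linarith⟩
  simp only [add_smul_pullDir_mem_ball_iff he hx]
  refine le_trans ?_ (hball _ ht)
  gcongr
  linarith

lemma integral_add_smul_dirRotation_le (hp : 2 ≤ p) (hs : 1 / 2 < s) (hs' : s < 1)
    {m κ γ M ε : ℝ} (hm : ∫ z, (z : E N) ∂jumpLaw N p s = m • e₁ N) (hκ : κ ∈ Ioc 0 (1 / 2))
    (hγ : γ ∈ Ioc 0 1) (hM : 0 < M) {e x q : E N} (he : ‖e‖ = 1) (hx : x ≠ 0) (hq : ‖q‖ = 1)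
    {U : E N → ℝ} (hU : ∀ z, U z ∈ Icc 0 ((coneGauge e z / M) ^ γ))
    (hUB : ∀ z ∈ ball ((coneGauge e x / 3) • e) (κ * (coneGauge e x / 3)), U z ≤ 0) :
    ∫ z : truncCone N p 1 (e₁ N), U (x + ε • dirRotation N q (z : E N)) ∂jumpLaw N p s ≤
      (coneGauge e x / M) ^ γ * (1 + γ * (-(gaugeSlope e x * (ε * m * ⟪pullDir e x, q⟫)) +
        10 * ∫ z : truncCone N p 1 (e₁ N),
          sqMin ‖(ε / coneGauge e x) • (z : E N)‖ ∂jumpLaw N p s) -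
        1 / 6 * (jumpLaw N p s).real {z | x + ε • dirRotation N q (z : E N) ∈
          ball ((coneGauge e x / 3) • e) (κ * (coneGauge e x / 3))}) := by
  have := isProbabilityMeasure_jumpLaw (N := N) hp hs hs'
  have hg := coneGauge_pos he hx
  have hstep := integral_barrier_add_le (integrable_smul_dirRotation hp hs hs' ε q) he hx hγ hM
    (ball_subset_ball (by nlinarith [hκ.2]))
    (measurableSet_add_smul_dirRotation_mem measurableSet_ball ε x q) hU hUB
  simpa only [norm_smul_dirRotation_div _ _ hg.le, integral_smul_dirRotation hm ε hq,
    real_inner_smul_right] using hstep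

/-- The drifts of the two players cancel, and the second-order error, which carries a factor `γ`,
is compensated by the probability of landing in the ball where `U` vanishes. -/
lemma exists_integral_add_integral_le (hp : 2 ≤ p) (hs : 1 / 2 < s) (hs' : s < 1) {κ : ℝ}
    (hκ : κ ∈ Ioc 0 (1 / 2)) : ∃ γ ∈ Ioc (0 : ℝ) 1, ∀ {M ε : ℝ} {e x y : E N} {U : E N → ℝ},
      0 < M → 0 < ε → ‖e‖ = 1 → 3 * ε ≤ coneGauge e x → ‖y‖ = 1 →
      (∀ z, U z ∈ Icc 0 ((coneGauge e z / M) ^ γ)) →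
      (∀ z ∈ ball ((coneGauge e x / 3) • e) (κ * (coneGauge e x / 3)), U z ≤ 0) →
      (∫ z : truncCone N p 1 (e₁ N),
          U (x + ε • dirRotation N (pullDir e x) (z : E N)) ∂jumpLaw N p s) +
        ∫ z : truncCone N p 1 (e₁ N), U (x + ε • dirRotation N y (z : E N)) ∂jumpLaw N p s ≤
          2 * (coneGauge e x / M) ^ γ := by
  obtain ⟨m, hm0, hm⟩ := exists_integral_jumpLaw_eq_smul (N := N) hp hs hs'
  obtain ⟨K, hK0, hK⟩ := exists_integral_sqMin_le (N := N) hp hs hs'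
  obtain ⟨c, hc0, hc⟩ := exists_le_jumpLaw_add_smul_pullDir_mem (N := N) hp hs hs' hκ.1
  have hγ : min 1 (c / (120 * K)) ∈ Ioc (0 : ℝ) 1 := ⟨by positivity, min_le_left _ _⟩
  have hγK : 120 * K * min 1 (c / (120 * K)) ≤ c :=
    (le_div_iff₀' (by positivity)).mp (min_le_right _ _)
  refine ⟨_, hγ, fun {M ε e x y U} hM hε he hG hy hU hUB ↦ ?_⟩
  set γ := min 1 (c / (120 * K))
  have hγ0 := hγ.1
  have hx : x ≠ 0 := norm_pos_iff.mp (by linarith [coneGauge_le he x])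
  have hg : 0 < coneGauge e x := coneGauge_pos he hx
  have hstep := fun {q : E N} (hq : ‖q‖ = 1) ↦
    integral_add_smul_dirRotation_le hp hs hs' (ε := ε) hm hκ hγ hM he hx hq hU hUB
  have hinner : -1 ≤ ⟪pullDir e x, y⟫ := by
    simpa only [norm_pullDir he, hy, one_mul] using neg_le_of_abs_le
      (abs_real_inner_le_norm (pullDir e x) y)
  have hdrift := mul_le_mul_of_nonneg_left (mul_le_mul_of_nonneg_left hinner
    (mul_nonneg (gaugeSlope_nonneg e x) (mul_nonneg hε.le hm0))) hγ0.le
  have herror : γ * (20 * (K * (ε / coneGauge e x) ^ (2 * s))) ≤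
      1 / 6 * (c * (ε / coneGauge e x) ^ (2 * s)) := by
    linear_combination (1 / 6 * (ε / coneGauge e x) ^ (2 * s)) * hγK
  have hsq := mul_le_mul_of_nonneg_left (hK (ε / coneGauge e x) (by positivity)).2 hγ0.le
  have hkill := hc he hε hG
  refine (add_le_add (hstep (norm_pullDir he x)) (hstep hy)).trans ?_
  rw [← mul_add, mul_comm 2, real_inner_self_eq_norm_sq, norm_pullDir he x]
  gcongr
  have hpos : 0 ≤ (jumpLaw N p s).real {z | x + ε • dirRotation N y (z : E N) ∈
      ball ((coneGauge e x / 3) • e) (κ * (coneGauge e x / 3))} := measureReal_nonneg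
  linarith

end BarrierStep

/-! ### The game process -/

section InfiniteProduct

variable {ι : Type*} {α : ι → Type*} [∀ i, MeasurableSpace (α i)] {β : Type*} [MeasurableSpace β]
  (P : ∀ i, Measure (α i)) [∀ i, IsProbabilityMeasure (P i)]

lemma indepFun_eval_infinitePi {S : Finset ι} {i : ι} (hi : i ∉ S) {f : (∀ i, α i) → β}
    (hf : Measurable f) (hdep : DependsOn f S) :
    IndepFun f (fun ω ↦ ω i) (Measure.infinitePi P) := by
  classical
  have o (j : ι) : α j := (nonempty_of_isProbabilityMeasure (P j)).some
  have hind := ((iIndepFun_infinitePi (P := P) (X := fun _ a ↦ a) fun _ ↦ measurable_id)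
      |>.indepFun_finset S {i} (by simpa) fun j ↦ measurable_pi_apply j).comp
    (hf.comp (measurable_updateFinset (x := o)))
    (measurable_pi_apply (⟨i, Finset.mem_singleton_self i⟩ : ({i} : Finset ι)))
  convert hind using 1
  · ext ω
    refine hdep fun j hj ↦ ?_
    simp [Function.updateFinset, Finset.mem_coe.mp hj]
  · rfl

lemma integral_comp_eval_infinitePi {S : Finset ι} {i : ι} (hi : i ∉ S) {f : (∀ i, α i) → β}
    (hf : Measurable f) (hdep : DependsOn f S) {g : β × α i → ℝ}
    (hg : Integrable g (((Measure.infinitePi P).map f).prod (P i))) :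
    ∫ ω, g (f ω, ω i) ∂Measure.infinitePi P =
      ∫ ω, ∫ a, g (f ω, a) ∂P i ∂Measure.infinitePi P := by
  have hmap : (Measure.infinitePi P).map (fun ω ↦ (f ω, ω i)) =
      ((Measure.infinitePi P).map f).prod (P i) := by
    rw [(indepFun_eval_infinitePi P hi hf hdep).map_prod_eq_prod_map_map hf.aemeasurable
      (measurable_pi_apply i).aemeasurable]
    congr 1
    exact Measure.infinitePi_map_eval P i
  rw [← integral_map (hf.prodMk (measurable_pi_apply i)).aemeasurable
    (hmap ▸ hg.aestronglyMeasurable), hmap, integral_prod _ hg,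
    integral_map hf.aemeasurable hg.integral_prod_left.aestronglyMeasurable]

end InfiniteProduct

section Positions

variable {N : ℕ} [N.AtLeastTwo] {p : ℝ}

lemma measurable_last : ∀ n, Measurable (History.last : History N p n → E N)
  | 0 => measurable_fst
  | n + 1 => measurable_fst.comp ((measurable_pi_apply (Fin.last n)).comp measurable_snd)

/-- The position reached from the history `h` when the next outcome is `o`. -/
def nextPosition (ε : ℝ) (σI σII : Strategy N p) {n : ℕ} (h : History N p n) (o : Outcome N p) :
    E N :=
  h.last + ε • dirRotation N (if o.2 then σI.move n h else σII.move n h : sphere (0 : E N) 1)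
    (o.1 : E N)

lemma measurable_nextPosition (ε : ℝ) (σI σII : Strategy N p) (n : ℕ) :
    Measurable fun q : History N p n × Outcome N p ↦ nextPosition ε σI σII q.1 q.2 := by
  have hy : Measurable fun q : History N p n × Outcome N p ↦
      (if q.2.2 then σI.move n q.1 else σII.move n q.1 : sphere (0 : E N) 1) :=
    .ite (measurable_snd.comp measurable_snd (measurableSet_singleton true))
      ((σI.measurable_move n).comp measurable_fst) ((σII.measurable_move n).comp measurable_fst)
  have hz : Measurable fun q : History N p n × Outcome N p ↦ (q.2.1 : E N) := by fun_prop
  exact ((measurable_last n).comp measurable_fst).add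
    ((measurable_dirRotation.comp ((measurable_subtype_coe.comp hy).prodMk hz)).const_smul ε)

variable (ε : ℝ) (x : E N) (σI σII : Strategy N p)

lemma gameHistory_succ (n : ℕ) (ω : ℕ → Outcome N p) : gameHistory ε x σI σII (n + 1) ω =
    (x, Fin.snoc (gameHistory ε x σI σII n ω).2
      (nextPosition ε σI σII (gameHistory ε x σI σII n ω) (ω n), ω n)) := rfl

lemma position_succ (n : ℕ) (ω : ℕ → Outcome N p) : position ε x σI σII (n + 1) ω =
    nextPosition ε σI σII (gameHistory ε x σI σII n ω) (ω n) := by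
  simp [position, gameHistory_succ, History.last]

lemma dist_position_succ (n : ℕ) (ω : ℕ → Outcome N p) :
    dist (position ε x σI σII (n + 1) ω) (position ε x σI σII n ω) =
      |ε| * ‖((ω n).1 : E N)‖ := by
  rw [position_succ, nextPosition, position, dist_self_add_left, norm_smul,
    LinearIsometryEquiv.norm_map, Real.norm_eq_abs]

lemma measurable_gameHistory (n : ℕ) : Measurable (gameHistory ε x σI σII n) := by
  induction n with
  | zero => exact measurable_const
  | succ n ih =>
    simp only [funext (gameHistory_succ ε x σI σII n)]
    refine measurable_const.prodMk (measurable_pi_lambda _ fun i ↦ ?_)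
    induction i using Fin.lastCases with
    | last =>
      simp only [Fin.snoc_last]
      exact ((measurable_nextPosition ε σI σII n).comp (ih.prodMk (measurable_pi_apply n))).prodMk
        (measurable_pi_apply n)
    | cast i =>
      simp only [Fin.snoc_castSucc]
      exact (measurable_pi_apply i).comp (measurable_snd.comp ih)

lemma measurable_position (n : ℕ) : Measurable (position ε x σI σII n) :=
  (measurable_last n).comp (measurable_gameHistory ε x σI σII n)

lemma dependsOn_gameHistory (n : ℕ) : DependsOn (gameHistory ε x σI σII n) (Finset.range n) := by
  induction n with
  | zero => exact fun _ _ _ ↦ rfl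
  | succ n ih =>
    intro ω ω' h
    rw [gameHistory_succ, gameHistory_succ, ih fun i hi ↦ h i (by grind), h n (by simp)]

variable (D : Set (E N))

/-- The game position stopped at the exit from `D`. -/
def stoppedPosition : ℕ → (ℕ → Outcome N p) → E N :=
  stoppedProcess (position ε x σI σII) (exitTime D ε x σI σII)

variable {D}

lemma stoppedPosition_zero : stoppedPosition ε x σI σII D 0 = fun _ ↦ x :=
  funext fun _ ↦ stoppedProcess_eq_of_le bot_le

lemma stoppedPosition_of_lt_exitTime (hx : x ∈ D) {n : ℕ} {ω : ℕ → Outcome N p}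
    (h : n < exitTime D ε x σI σII ω) : stoppedPosition ε x σI σII D n ω =
      position ε x σI σII n ω ∧ position ε x σI σII n ω ∈ D := by
  refine ⟨stoppedProcess_eq_of_le h.le, ?_⟩
  rcases Nat.eq_zero_or_pos n with rfl | hn
  · exact hx
  · exact not_not.mp (notMem_of_lt_hittingAfter h hn)

lemma stoppedPosition_of_exitTime_le {n : ℕ} {ω : ℕ → Outcome N p}
    (h : exitTime D ε x σI σII ω ≤ n) : stoppedPosition ε x σI σII D n ω =
      exitPosition D ε x σI σII ω ∧ exitPosition D ε x σI σII ω ∉ D :=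
  ⟨stoppedProcess_eq_of_ge h, hittingAfter_mem_set_of_ne_top (h.trans_lt (WithTop.coe_lt_top n)).ne⟩

lemma stoppedPosition_eq_last (hx : x ∈ D) {n : ℕ} {ω : ℕ → Outcome N p}
    (h : stoppedPosition ε x σI σII D n ω ∈ D) :
    stoppedPosition ε x σI σII D n ω = (gameHistory ε x σI σII n ω).last := by
  rcases lt_or_ge (n : WithTop ℕ) (exitTime D ε x σI σII ω) with hn | hn
  · exact (stoppedPosition_of_lt_exitTime ε x σI σII hx hn).1
  · have hexit := stoppedPosition_of_exitTime_le ε x σI σII hn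
    exact (hexit.2 (hexit.1 ▸ h)).elim

open Classical in
lemma stoppedPosition_succ (hx : x ∈ D) (n : ℕ) (ω : ℕ → Outcome N p) :
    stoppedPosition ε x σI σII D (n + 1) ω =
      if stoppedPosition ε x σI σII D n ω ∈ D
      then nextPosition ε σI σII (gameHistory ε x σI σII n ω) (ω n)
      else stoppedPosition ε x σI σII D n ω := by
  rcases lt_or_ge (n : WithTop ℕ) (exitTime D ε x σI σII ω) with hn | hn
  · obtain ⟨heq, hmem⟩ := stoppedPosition_of_lt_exitTime ε x σI σII hx hn
    rw [if_pos (heq ▸ hmem), ← position_succ]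
    exact stoppedProcess_eq_of_le (ENat.natCast_add_one_le_iff.mpr hn)
  · obtain ⟨heq, hmem⟩ := stoppedPosition_of_exitTime_le ε x σI σII hn
    rw [if_neg (heq ▸ hmem), heq]
    exact stoppedProcess_eq_of_ge (hn.trans (WithTop.coe_le_coe.mpr n.le_succ))

lemma measurable_stoppedPosition (hD : MeasurableSet D) (hx : x ∈ D) (n : ℕ) :
    Measurable (stoppedPosition ε x σI σII D n) := by
  induction n with
  | zero => exact stoppedPosition_zero ε x σI σII ▸ measurable_const
  | succ n ih =>
    simp only [funext (stoppedPosition_succ ε x σI σII hx n), ← position_succ]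
    exact .ite (ih hD) (measurable_position ε x σI σII (n + 1)) ih

lemma dependsOn_stoppedPosition (hx : x ∈ D) (n : ℕ) :
    DependsOn (stoppedPosition ε x σI σII D n) (Finset.range n) := by
  induction n with
  | zero => exact fun _ _ _ ↦ by simp only [stoppedPosition_zero]
  | succ n ih =>
    intro ω ω' h
    have h' : ∀ i ∈ (Finset.range n : Set ℕ), ω i = ω' i := fun i hi ↦ h i (by grind)
    rw [stoppedPosition_succ _ _ _ _ hx, stoppedPosition_succ _ _ _ _ hx, ih h',
      dependsOn_gameHistory ε x σI σII n h', h n (by simp)]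

end Positions

/-! ### Barriers and exit probabilities -/

lemma integrable_comp_of_mem_Icc {α β : Type*} [MeasurableSpace α] [MeasurableSpace β]
    {μ : Measure α} [IsFiniteMeasure μ] {V : β → ℝ} (hV : Measurable V) {a b : ℝ}
    (hVab : ∀ z, V z ∈ Icc a b) {f : α → β} (hf : Measurable f) :
    Integrable (fun a ↦ V (f a)) μ :=
  .of_mem_Icc a b (hV.comp hf).aemeasurable (.of_forall fun _ ↦ hVab _)

section ExitProbability

variable {N : ℕ} [N.AtLeastTwo] {p s : ℝ}

instance : IsProbabilityMeasure (uniformOn (univ : Set Bool)) :=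
  isProbabilityMeasure_uniformOn finite_univ univ_nonempty

instance [IsProbabilityMeasure (jumpLaw N p s)] : IsProbabilityMeasure (outcomeLaw N p s) :=
  inferInstanceAs (IsProbabilityMeasure ((jumpLaw N p s).prod (uniformOn univ)))

instance [IsProbabilityMeasure (jumpLaw N p s)] : IsProbabilityMeasure (gameMeasure N p s) :=
  inferInstanceAs (IsProbabilityMeasure (Measure.infinitePi fun _ ↦ outcomeLaw N p s))

lemma integral_outcomeLaw [IsProbabilityMeasure (jumpLaw N p s)] {f : Outcome N p → ℝ}
    (hf : Integrable f (outcomeLaw N p s)) :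
    ∫ o, f o ∂outcomeLaw N p s =
      ((∫ z, f (z, true) ∂jumpLaw N p s) + ∫ z, f (z, false) ∂jumpLaw N p s) / 2 := by
  have hhalf (b : Bool) : (uniformOn (univ : Set Bool)).real {b} = 1 / 2 := by
    rw [measureReal_def, uniformOn_univ]
    simp
  rw [outcomeLaw, integral_prod_symm _ hf, integral_fintype .of_finite]
  simp only [Fintype.sum_bool, hhalf, smul_eq_mul]
  ring

variable {D : Set (E N)} {ε : ℝ} {x : E N} {σI σII : Strategy N p}

lemma integral_stoppedPosition_succ_le [IsProbabilityMeasure (jumpLaw N p s)]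
    (hD : MeasurableSet D) (hx : x ∈ D) {V : E N → ℝ} (hV : Measurable V)
    (hV01 : ∀ z, V z ∈ Icc 0 1) {n : ℕ}
    (hstep : ∀ h : History N p n, h.last ∈ D →
      ∫ o, V (nextPosition ε σI σII h o) ∂outcomeLaw N p s ≤ V h.last) :
    ∫ ω, V (stoppedPosition ε x σI σII D (n + 1) ω) ∂gameMeasure N p s ≤
      ∫ ω, V (stoppedPosition ε x σI σII D n ω) ∂gameMeasure N p s := by
  classical
  set state : (ℕ → Outcome N p) → History N p n × E N :=
    fun ω ↦ (gameHistory ε x σI σII n ω, stoppedPosition ε x σI σII D n ω)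
  have hstate : Measurable state := (measurable_gameHistory ε x σI σII n).prodMk
    (measurable_stoppedPosition ε x σI σII hD hx n)
  have hdep : DependsOn state (Finset.range n) := fun ω ω' h ↦ Prod.ext
    (dependsOn_gameHistory ε x σI σII n h) (dependsOn_stoppedPosition ε x σI σII hx n h)
  set next : (History N p n × E N) × Outcome N p → E N :=
    fun q ↦ if q.1.2 ∈ D then nextPosition ε σI σII q.1.1 q.2 else q.1.2
  have hnext : Measurable next := .ite ((measurable_snd.comp measurable_fst) hD)
    ((measurable_nextPosition ε σI σII n).comp
      ((measurable_fst.comp measurable_fst).prodMk measurable_snd))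
    (measurable_snd.comp measurable_fst)
  have : IsProbabilityMeasure ((gameMeasure N p s).map state) :=
    Measure.isProbabilityMeasure_map hstate.aemeasurable
  calc ∫ ω, V (stoppedPosition ε x σI σII D (n + 1) ω) ∂gameMeasure N p s
    _ = ∫ ω, V (next (state ω, ω n)) ∂gameMeasure N p s := by
        simp only [stoppedPosition_succ ε x σI σII hx, next, state]
    _ = ∫ ω, ∫ o, V (next (state ω, o)) ∂outcomeLaw N p s ∂gameMeasure N p s :=
        integral_comp_eval_infinitePi (fun _ ↦ outcomeLaw N p s) Finset.notMem_range_self hstate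
          hdep (g := fun q ↦ V (next q)) (integrable_comp_of_mem_Icc
            (μ := ((gameMeasure N p s).map state).prod (outcomeLaw N p s)) hV hV01 hnext)
    _ ≤ _ := integral_mono_of_nonneg
        (.of_forall fun ω ↦ integral_nonneg fun o ↦ (hV01 _).1)
        (integrable_comp_of_mem_Icc hV hV01 (measurable_stoppedPosition ε x σI σII hD hx n))
        (.of_forall fun ω ↦ ?_)
  by_cases hω : stoppedPosition ε x σI σII D n ω ∈ D
  · have hlast := stoppedPosition_eq_last ε x σI σII hx hω
    simp only [next, state, if_pos hω]
    exact (hstep _ (hlast ▸ hω)).trans_eq (congrArg V hlast.symm)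
  · simp only [next, state, if_neg hω, integral_const, probReal_univ, one_smul, le_refl]

lemma integral_stoppedPosition_le [IsProbabilityMeasure (jumpLaw N p s)]
    (hD : MeasurableSet D) (hx : x ∈ D) {V : E N → ℝ} (hV : Measurable V)
    (hV01 : ∀ z, V z ∈ Icc 0 1)
    (hstep : ∀ n, ∀ h : History N p n, h.last ∈ D →
      ∫ o, V (nextPosition ε σI σII h o) ∂outcomeLaw N p s ≤ V h.last) (n : ℕ) :
    ∫ ω, V (stoppedPosition ε x σI σII D n ω) ∂gameMeasure N p s ≤ V x := by
  induction n with
  | zero => simp [stoppedPosition_zero]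
  | succ n ih => exact (integral_stoppedPosition_succ_le hD hx hV hV01 (hstep n)).trans ih

lemma gameMeasure_exitTime_eq_top (hp : 2 ≤ p) (hs : 1 / 2 < s) (hs' : s < 1) (hε : 0 < ε)
    (hD : Bornology.IsBounded D) (hx : x ∈ D) :
    gameMeasure N p s {ω | exitTime D ε x σI σII ω = ⊤} = 0 := by
  have := isProbabilityMeasure_jumpLaw (N := N) hp hs hs'
  obtain ⟨C, hC⟩ := Metric.isBounded_iff.mp hD
  set short : Set (Outcome N p) := {o | ‖(o.1 : E N)‖ ≤ C / ε}
  have hshort : outcomeLaw N p s short < 1 :=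
    ((measurePreserving_fst (μ := jumpLaw N p s)
      (ν := uniformOn (univ : Set Bool))).measure_preimage
        (measurableSet_le (by fun_prop) measurable_const).nullMeasurableSet).trans_lt
      (jumpLaw_norm_le_lt_one hp hs hs' (C / ε))
  refine le_antisymm (ge_of_tendsto' (ENNReal.tendsto_pow_atTop_nhds_zero_of_lt_one hshort)
    fun n ↦ ?_) zero_le
  calc gameMeasure N p s {ω | exitTime D ε x σI σII ω = ⊤}
    _ ≤ gameMeasure N p s (Set.pi (Finset.range n) fun _ ↦ short) :=
        measure_mono fun ω hω i _ ↦ ?_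
    _ = outcomeLaw N p s short ^ n := by
        rw [gameMeasure, Measure.infinitePi_pi _
          fun _ _ ↦ measurableSet_le (by fun_prop) measurable_const, Finset.prod_const,
          Finset.card_range]
  have hmem (j : ℕ) : position ε x σI σII j ω ∈ D := by
    have hj : (j : WithTop ℕ) < exitTime D ε x σI σII ω := hω ▸ WithTop.coe_lt_top j
    exact (stoppedPosition_of_lt_exitTime ε x σI σII hx hj).2
  have hdist := hC (hmem (i + 1)) (hmem i)
  rwa [dist_position_succ, abs_of_pos hε, mul_comm, ← le_div_iff₀ hε] at hdist

/-- The event that the game started at `x` ends, with its exit position from `D` in `B`. -/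
def exitsThrough (D B : Set (E N)) (ε : ℝ) (x : E N) (σI σII : Strategy N p) :
    Set (ℕ → Outcome N p) :=
  {ω | exitTime D ε x σI σII ω < ⊤ ∧ exitPosition D ε x σI σII ω ∈ B}

lemma exitsThrough_diff_subset {D' B : Set (E N)} (hD : D' ⊆ D) :
    exitsThrough D' (B \ D) ε x σI σII ⊆ exitsThrough D B ε x σI σII := by
  rintro ω ⟨hlt, hB, hexit⟩
  obtain ⟨k, hk⟩ := WithTop.ne_top_iff_exists.mp hlt.ne
  have hpos : exitPosition D' ε x σI σII ω = position ε x σI σII k ω := by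
    rw [exitPosition, stoppedValue, ← hk]
    rfl
  have hle : exitTime D ε x σI σII ω ≤ k :=
    hittingAfter_le_of_mem (WithTop.coe_le_coe.mp (hk ▸ le_hittingAfter ω)) (hpos ▸ hexit)
  have heq : exitTime D ε x σI σII ω = exitTime D' ε x σI σII ω :=
    le_antisymm (hk ▸ hle) (hittingAfter_apply_anti _ 1 ω (compl_subset_compl.mpr hD))
  refine ⟨heq ▸ hlt, ?_⟩
  rwa [exitPosition, stoppedValue, heq]

lemma gameMeasure_exitsThrough_le [IsProbabilityMeasure (jumpLaw N p s)]
    (hD : MeasurableSet D) (hx : x ∈ D) {B : Set (E N)} {V : E N → ℝ} (hV : Measurable V)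
    (hV01 : ∀ z, V z ∈ Icc 0 1) (hVB : ∀ z ∉ D, z ∈ B → 1 ≤ V z)
    (hstep : ∀ n, ∀ h : History N p n, h.last ∈ D →
      ∫ o, V (nextPosition ε σI σII h o) ∂outcomeLaw N p s ≤ V h.last) :
    gameMeasure N p s (exitsThrough D B ε x σI σII) ≤ ENNReal.ofReal (V x) := by
  set exitsBy : ℕ → Set (ℕ → Outcome N p) :=
    fun n ↦ {ω | exitTime D ε x σI σII ω ≤ n ∧ exitPosition D ε x σI σII ω ∈ B}
  have hmono : Monotone exitsBy := fun m n hmn ω hω ↦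
    ⟨hω.1.trans (WithTop.coe_le_coe.mpr hmn), hω.2⟩
  have hmarkov (n : ℕ) : gameMeasure N p s (exitsBy n) ≤ ENNReal.ofReal (V x) := by
    have hint := mul_meas_ge_le_integral_of_nonneg (.of_forall fun ω ↦ (hV01 _).1)
      (integrable_comp_of_mem_Icc (μ := gameMeasure N p s) hV hV01
        (measurable_stoppedPosition ε x σI σII hD hx n)) 1
    rw [one_mul] at hint
    rw [← ofReal_measureReal]
    refine ENNReal.ofReal_le_ofReal ((measureReal_mono fun ω hω ↦ ?_).trans
      (hint.trans (integral_stoppedPosition_le hD hx hV hV01 hstep n)))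
    obtain ⟨heq, hexit⟩ := stoppedPosition_of_exitTime_le ε x σI σII hω.1
    exact (hVB _ hexit hω.2).trans_eq (congrArg V heq.symm)
  have hunion : exitsThrough D B ε x σI σII ⊆ ⋃ n, exitsBy n := by
    rintro ω ⟨hlt, hB⟩
    obtain ⟨k, hk⟩ := WithTop.ne_top_iff_exists.mp hlt.ne
    exact mem_iUnion.mpr ⟨k, hk.ge, hB⟩
  exact (measure_mono hunion).trans (hmono.measure_iUnion.trans_le (iSup_le hmarkov))

lemma one_sub_le_exitsThrough (hp : 2 ≤ p) (hs : 1 / 2 < s) (hs' : s < 1) (hε : 0 < ε)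
    (hD : MeasurableSet D) (hDb : Bornology.IsBounded D) (hx : x ∈ D) {B : Set (E N)}
    {V : E N → ℝ} (hV : Measurable V) (hV01 : ∀ z, V z ∈ Icc 0 1)
    (hVB : ∀ z ∉ D, z ∉ B → 1 ≤ V z)
    (hstep : ∀ n, ∀ h : History N p n, h.last ∈ D →
      ∫ o, V (nextPosition ε σI σII h o) ∂outcomeLaw N p s ≤ V h.last) :
    1 - V x ≤ (gameMeasure N p s).real (exitsThrough D B ε x σI σII) := by
  have := isProbabilityMeasure_jumpLaw (N := N) hp hs hs'
  set good := exitsThrough D B ε x σI σII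
  have hcompl : goodᶜ ⊆
      {ω | exitTime D ε x σI σII ω = ⊤} ∪ exitsThrough D Bᶜ ε x σI σII := fun ω hω ↦
    or_iff_not_imp_left.mpr fun htop ↦
      have hlt := lt_top_iff_ne_top.mpr htop
      ⟨hlt, fun hB ↦ hω ⟨hlt, hB⟩⟩
  have hbad : gameMeasure N p s goodᶜ ≤ ENNReal.ofReal (V x) := by
    refine (measure_mono hcompl).trans ((measure_union_le _ _).trans ?_)
    rw [gameMeasure_exitTime_eq_top hp hs hs' hε hDb hx, zero_add]
    exact gameMeasure_exitsThrough_le hD hx hV hV01 hVB hstep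
  have hone := measureReal_union_le (μ := gameMeasure N p s) good goodᶜ
  rw [union_compl_self, probReal_univ] at hone
  have : (gameMeasure N p s).real goodᶜ ≤ V x := ENNReal.toReal_le_of_le_ofReal (hV01 x).1 hbad
  linarith

end ExitProbability

/-! ### The pulling strategy -/

section Barrier

variable {F : Type*} [NormedAddCommGroup F] [InnerProductSpace ℝ F] {A : Set F} {v e z : F}
  {M γ : ℝ}

/-- The barrier of Player I: a power of the gauge with vertex `v`, which measures the danger of
exiting far away, set to zero on the target set `A`. -/
def barrier (A : Set F) (v e : F) (M γ : ℝ) : F → ℝ :=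
  Aᶜ.indicator fun z ↦ min 1 ((coneGauge e (z - v) / M) ^ γ)

lemma measurable_barrier [MeasurableSpace F] [BorelSpace F] (hA : MeasurableSet A) :
    Measurable (barrier A v e M γ) :=
  (measurable_const.min ((((continuous_coneGauge e).measurable.comp
    (measurable_sub_const v)).div_const M).pow_const γ)).indicator hA.compl

lemma barrier_of_notMem (hz : z ∉ A) :
    barrier A v e M γ z = min 1 ((coneGauge e (z - v) / M) ^ γ) :=
  indicator_of_mem hz _

lemma barrier_of_mem (hz : z ∈ A) : barrier A v e M γ z = 0 :=
  indicator_of_notMem (not_not.mpr hz) _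

lemma barrier_mem_Icc (he : ‖e‖ = 1) (hM : 0 < M) (z : F) : barrier A v e M γ z ∈ Icc 0 1 := by
  have := coneGauge_nonneg he (z - v)
  by_cases hz : z ∈ A
  · rw [barrier_of_mem hz]
    exact ⟨le_rfl, zero_le_one⟩
  · rw [barrier_of_notMem hz]
    exact ⟨le_min zero_le_one (by positivity), min_le_left _ _⟩

lemma barrier_le_rpow (he : ‖e‖ = 1) (hM : 0 < M) (z : F) :
    barrier A v e M γ z ≤ (coneGauge e (z - v) / M) ^ γ := by
  have := coneGauge_nonneg he (z - v)
  by_cases hz : z ∈ A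
  · exact barrier_of_mem hz ▸ by positivity
  · exact barrier_of_notMem hz ▸ min_le_right _ _

lemma one_le_barrier (hM : 0 < M) (hγ : 0 ≤ γ) (hA : z ∉ A) (hz : M ≤ coneGauge e (z - v)) :
    1 ≤ barrier A v e M γ z :=
  barrier_of_notMem hA ▸ le_min le_rfl (Real.one_le_rpow ((one_le_div hM).mpr hz) hγ)

lemma barrier_of_coneGauge_le (he : ‖e‖ = 1) (hM : 0 < M) (hγ : 0 ≤ γ) (hA : z ∉ A)
    (hz : coneGauge e (z - v) ≤ M) : barrier A v e M γ z = (coneGauge e (z - v) / M) ^ γ := by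
  have := coneGauge_nonneg he (z - v)
  rw [barrier_of_notMem hA, min_eq_right
    (Real.rpow_le_one (by positivity) ((div_le_one hM).mpr hz) hγ)]

lemma ball_subset_ball_diff {D : Set F} {x : F} (he : ‖e‖ = 1) {κ r g : ℝ}
    (hκ : κ ∈ Ioc 0 (1 / 2)) (hr : r ∈ Ioc 0 M) (hg : g ∈ Icc 0 M)
    (hcone : ∀ t ∈ Ioc 0 (2 * M), Disjoint (ball (x + t • e) (κ * t)) D) :
    ball (x + r • e + (g / 3) • e) (κ * (g / 3)) ⊆ ball x (2 * M) \ D := by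
  obtain ⟨hr0, hrM⟩ := hr
  obtain ⟨hg0, hgM⟩ := hg
  have hκ0 := hκ.1
  rw [add_assoc, ← add_smul]
  refine (ball_subset_ball (by gcongr; linarith)).trans (subset_sdiff.mpr
    ⟨ball_subset_ball' ?_, hcone (r + g / 3) ⟨by linarith, by linarith⟩⟩)
  rw [dist_self_add_left, norm_smul, he, mul_one, Real.norm_of_nonneg (by linarith)]
  nlinarith [hκ.2]

lemma mem_ball_of_coneGauge_lt (he : ‖e‖ = 1) {x : F} {r : ℝ} (hr : 0 ≤ r)
    (hz : coneGauge e (z - (x + r • e)) < M) : z ∈ ball x (M + r) := by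
  refine ball_subset_ball' ?_ (mem_ball_iff_norm.mpr ((norm_le_coneGauge he _).trans_lt hz))
  rw [dist_self_add_left, norm_smul, he, mul_one, Real.norm_of_nonneg hr]

end Barrier

section PullStrategy

variable {N : ℕ} [N.AtLeastTwo] {p s : ℝ}

/-- The strategy of pulling towards the centre of the level sphere of the gauge with vertex `v`
and axis `e` that passes through the current position. -/
def pullStrategy (v : E N) {e : E N} (he : ‖e‖ = 1) : Strategy N p where
  move _ h := ⟨pullDir e (h.last - v), mem_sphere_zero_iff_norm.mpr (norm_pullDir he _)⟩
  measurable_move n := ((measurable_pullDir e).comp ((measurable_last n).sub_const v)).subtype_mk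

lemma exists_integral_barrier_nextPosition_le (hp : 2 ≤ p) (hs : 1 / 2 < s) (hs' : s < 1) {κ : ℝ}
    (hκ : κ ∈ Ioc 0 (1 / 2)) : ∃ γ ∈ Ioc (0 : ℝ) 1, ∀ {A : Set (E N)} {v e : E N} {M ε : ℝ}
      (he : ‖e‖ = 1) {σII : Strategy N p} {n : ℕ} {h : History N p n}, MeasurableSet A → 0 < M →
      0 < ε → h.last ∉ A → coneGauge e (h.last - v) ∈ Icc (3 * ε) M →
      ball (v + (coneGauge e (h.last - v) / 3) • e) (κ * (coneGauge e (h.last - v) / 3)) ⊆ A →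
      ∫ o, barrier A v e M γ (nextPosition ε (pullStrategy v he) σII h o) ∂outcomeLaw N p s ≤
        barrier A v e M γ h.last := by
  obtain ⟨γ, hγ, hkey⟩ := exists_integral_add_integral_le (N := N) hp hs hs' hκ
  refine ⟨γ, hγ, fun {A v e M ε} he {σII n h} hA hM hε hlast hG hball ↦ ?_⟩
  have := isProbabilityMeasure_jumpLaw (N := N) hp hs hs'
  have hU (z : E N) : barrier A v e M γ (v + z) ∈ Icc 0 ((coneGauge e z / M) ^ γ) := by
    have hle := barrier_le_rpow (A := A) (v := v) (γ := γ) he hM (v + z)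
    rw [add_sub_cancel_left] at hle
    exact ⟨(barrier_mem_Icc he hM _).1, hle⟩
  have hU0 (z : E N) (hz : z ∈ ball ((coneGauge e (h.last - v) / 3) • e)
      (κ * (coneGauge e (h.last - v) / 3))) : barrier A v e M γ (v + z) ≤ 0 :=
    (barrier_of_mem (hball (by simpa only [mem_ball, dist_add_left] using hz))).le
  have hround := hkey hM hε he hG.1 (norm_eq_of_mem_sphere (σII.move n h)) hU hU0
  have hnext : Measurable (nextPosition ε (pullStrategy v he) σII h) :=
    (measurable_nextPosition ε _ σII n).comp measurable_prodMk_left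
  rw [integral_outcomeLaw (integrable_comp_of_mem_Icc (measurable_barrier hA)
    (barrier_mem_Icc he hM) hnext), barrier_of_coneGauge_le he hM hγ.1.le hlast hG.2,
    div_le_iff₀ two_pos, mul_comm]
  simp only [← add_assoc, add_sub_cancel] at hround
  exact hround

lemma exists_one_sub_rpow_le_exitsThrough (hp : 2 ≤ p) (hs : 1 / 2 < s) (hs' : s < 1) {κ : ℝ}
    (hκ : κ ∈ Ioc 0 (1 / 2)) : ∃ γ ∈ Ioc (0 : ℝ) 1, ∀ {D : Set (E N)} {x x' e : E N}
      (he : ‖e‖ = 1) {M r ε : ℝ} (σII : Strategy N p), MeasurableSet D → r ∈ Ioc 0 M → 0 < ε →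
      3 * ε ≤ κ * r → (∀ t ∈ Ioc 0 (2 * M), Disjoint (ball (x + t • e) (κ * t)) D) →
      x' ∈ D → coneGauge e (x' - (x + r • e)) < M →
      1 - (coneGauge e (x' - (x + r • e)) / M) ^ γ ≤ (gameMeasure N p s).real
        (exitsThrough D (ball x (2 * M)) ε x' (pullStrategy (x + r • e) he) σII) := by
  obtain ⟨γ, hγ, hstep⟩ := exists_integral_barrier_nextPosition_le (N := N) hp hs hs' hκ
  refine ⟨γ, hγ, fun {D x x' e} he {M r ε} σII hD hr hε hεr hcone hx' hx'M ↦ ?_⟩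
  have := isProbabilityMeasure_jumpLaw (N := N) hp hs hs'
  have hM : 0 < M := hr.1.trans_le hr.2
  set v := x + r • e
  set A := ball x (2 * M) \ D
  set D' := D ∩ {z | coneGauge e (z - v) < M}
  have hA : MeasurableSet A := measurableSet_ball.diff hD
  have hG : Measurable fun z ↦ coneGauge e (z - v) :=
    (continuous_coneGauge e).measurable.comp (measurable_sub_const v)
  have hD' : MeasurableSet D' := hD.inter (measurableSet_lt hG measurable_const)
  have hbdd : Bornology.IsBounded D' := isBounded_ball.subset fun z hz ↦
    mem_ball_iff_norm.mpr ((norm_le_coneGauge he (z - v)).trans_lt hz.2)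
  have hfar (z : E N) (hz : z ∈ D) : 3 * ε ≤ coneGauge e (z - v) := by
    refine hεr.trans (le_trans ?_ (norm_le_coneGauge he (z - v)))
    have := disjoint_right.mp (hcone r ⟨hr.1, by linarith [hr.2]⟩) hz
    rwa [mem_ball_iff_norm, not_lt] at this
  have hout (z : E N) (hzD : z ∉ D') (hzA : z ∉ A) : 1 ≤ barrier A v e M γ z := by
    refine one_le_barrier hM hγ.1.le hzA (not_lt.mp fun hz ↦ ?_)
    have hball : z ∈ ball x (2 * M) :=
      ball_subset_ball (by linarith [hr.2]) (mem_ball_of_coneGauge_lt he hr.1.le hz)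
    exact hzA ⟨hball, fun h ↦ hzD ⟨h, hz⟩⟩
  calc 1 - (coneGauge e (x' - v) / M) ^ γ
    _ ≤ 1 - barrier A v e M γ x' := sub_le_sub_left (barrier_le_rpow he hM x') 1
    _ ≤ (gameMeasure N p s).real (exitsThrough D' A ε x' (pullStrategy v he) σII) :=
        one_sub_le_exitsThrough hp hs hs' hε hD' hbdd ⟨hx', hx'M⟩ (measurable_barrier hA)
          (barrier_mem_Icc he hM) hout fun n h hh ↦ hstep he hA hM hε (fun hhA ↦ hhA.2 hh.1)
            ⟨hfar _ hh.1, hh.2.le⟩ (ball_subset_ball_diff he hκ hr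
              ⟨coneGauge_nonneg he _, hh.2.le⟩ hcone)
    _ ≤ _ := measureReal_mono (exitsThrough_diff_subset inter_subset_left)

lemma exists_disjoint_ball_of_finiteCone {β : ℝ} (hβ : 0 < β) : ∃ κ ∈ Ioc (0 : ℝ) (1 / 2),
    ∀ {h : ℝ} {D : Set (E N)} {x : E N} (S : E N ≃ₗᵢ[ℝ] E N),
      (∀ z ∈ finiteCone N β h, x + S z ∉ D) →
      ∀ t ∈ Ioc 0 (h / 2), Disjoint (ball (x + t • S (e₁ N)) (κ * t)) D := by
  obtain ⟨κ, hκ0, hκ, hball⟩ := exists_ball_subset_cone (norm_e₁ (N := N)) hβ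
  refine ⟨κ, ⟨hκ0, hκ⟩, fun {h D x} S hS t ht ↦ disjoint_left.mpr fun z hz ↦ ?_⟩
  have hmem : S.symm (z - x) ∈ ball (t • e₁ N) (κ * t) := by
    rw [mem_ball_iff_norm, ← S.norm_map, map_sub, S.apply_symm_apply, map_smul, sub_sub,
      ← mem_ball_iff_norm]
    exact hz
  obtain ⟨hangle, hlower, hupper⟩ := hball t ht.1 hmem
  have hout := hS _ ⟨hangle, by linarith [ht.1], by linarith [ht.2]⟩
  rwa [S.apply_symm_apply, add_sub_cancel] at hout

end PullStrategy

lemma exists_forall_rpow_div_le {ξ γ M : ℝ} (hξ : 0 < ξ) (hγ : 0 < γ) (hM : 0 < M) :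
    ∃ ρ ∈ Ioc 0 M, ∀ g ∈ Ico 0 ρ, (g / M) ^ γ ≤ ξ := by
  refine ⟨M * min 1 (ξ ^ γ⁻¹), ⟨by positivity, mul_le_of_le_one_right hM.le (min_le_left _ _)⟩,
    fun g hg ↦ ?_⟩
  have hgM : g / M ≤ ξ ^ γ⁻¹ := (div_le_iff₀' hM).mpr
    (hg.2.le.trans (mul_le_mul_of_nonneg_left (min_le_right _ _) hM.le))
  exact (Real.rpow_le_rpow (div_nonneg hg.1 hM.le) hgM hγ.le).trans_eq
    (Real.rpow_inv_rpow hξ.le hγ.ne')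

end TugOfWar

end

open TugOfWar Metric Set in
theorem theorem8p4_general {N : ℕ} [N.AtLeastTwo] {p s : ℝ} (hp : 2 ≤ p) (hs : 1 / 2 < s)
    (hs' : s < 1) {D : Set (E N)} (hD : MeasurableSet D) {x : E N} {β h : ℝ} (hβ : 0 < β)
    (hh : 0 < h) (S : E N ≃ₗᵢ[ℝ] E N) (hS : ∀ z ∈ finiteCone N β h, x + S z ∉ D) :
    GameRegular p s D x := by
  obtain ⟨κ, hκ, hcone⟩ := exists_disjoint_ball_of_finiteCone (N := N) hβ
  obtain ⟨γ, hγ, hexit⟩ := exists_one_sub_rpow_le_exitsThrough (N := N) hp hs hs' hκ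
  intro ξ hξ δ hδ
  have he : ‖S (e₁ N)‖ = 1 := by rw [S.norm_map, norm_e₁]
  set M := min δ (h / 2) / 2
  have hM : 2 * M = min δ (h / 2) := mul_div_cancel₀ _ two_ne_zero
  obtain ⟨ρ, hρ, hρξ⟩ := exists_forall_rpow_div_le hξ hγ.1 (M := M) (by positivity)
  have hκ0 := hκ.1
  have hρ0 := hρ.1
  refine ⟨ρ / 6, by positivity, κ * (ρ / 6) / 3, by positivity, fun ε hε hε' x' hx' ↦
    ⟨pullStrategy (x + (ρ / 6) • S (e₁ N)) he, fun σII ↦ ?_⟩⟩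
  have := isProbabilityMeasure_jumpLaw (N := N) hp hs hs'
  have hgauge : coneGauge (S (e₁ N)) (x' - (x + (ρ / 6) • S (e₁ N))) < ρ := by
    have hdist := mem_ball_iff_norm.mp hx'.1
    have hnorm := norm_sub_le (x' - x) ((ρ / 6) • S (e₁ N))
    rw [norm_smul, he, mul_one, Real.norm_of_nonneg (by positivity), sub_sub] at hnorm
    linarith [coneGauge_le he (x' - (x + (ρ / 6) • S (e₁ N)))]
  refine (sub_le_sub_left (hρξ _ ⟨coneGauge_nonneg he _, hgauge⟩) 1).trans
    ((hexit he σII hD ⟨by positivity, by linarith [hρ.2]⟩ hε (by linarith)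
      (fun t ht ↦ hcone S hS t ⟨ht.1, ht.2.trans (hM.trans_le (min_le_right _ _))⟩) hx'.2
      (hgauge.trans_le hρ.2)).trans (MeasureTheory.measureReal_mono fun ω hω ↦
        ⟨hω.1, ball_subset_ball (hM.trans_le (min_le_left _ _)) hω.2⟩))

theorem theorem8p4 (N : ℕ) [N.AtLeastTwo] (p s : ℝ) (hp : 2 ≤ p) (hs : 1 / 2 < s) (hs' : s < 1)
    (D : Set (TugOfWar.E N)) (hD_open : IsOpen D) (hD_bdd : Bornology.IsBounded D)
    (hD_cone : TugOfWar.ExteriorConeCondition D) :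
    ∀ x ∈ frontier D, TugOfWar.GameRegular p s D x := by
  obtain ⟨β, hβ, h, hh, hcone⟩ := hD_cone
  intro x hx
  obtain ⟨S, -, hS⟩ := hcone x hx
  exact theorem8p4_general hp hs hs' hD_open.measurableSet hβ.1 hh S hS
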